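/- **Setting.** Let $N\ge 1$ and let $\mathcal G$ be a directed graph without self-loops on the nodes $1,\dots,N$. Let $\mathcal V_i=\{j:(j,i)\in\mathcal E\}$ be the neighbourhood of $i$, listed in ascending order, let $p_i=|\mathcal V_i|$ be the in-degree and $q_i=|\{j: i\in\mathcal V_j\}|$ the out-degree. Let $0=t_0<t_1<\cdots$, $t_k\to\infty$, be sampling instants such that $$\tau_i=\sup_k\,(t_{k+1}-t_{k-p_i+1})<\infty ,\qquad i=1,\dots,N ,$$ with $t_m:=0$ for $m<0$. Let $\Pi\{j_1,\dots,j_p\}=\{j_p,j_1,\dots,j_{p-1}\}$ and let $\nu_j=\nu_j^{k,i}\in\{1,\dots,p_i\}$ be the position of $j$ in $\Pi^k(\mathcal V_i)$. The plant and the measurements are $$\dot x=Ax+B_2w,\quad x(t)=x_0\in\mathbb R^n\ (t\le 0),\qquad y_i=C_ix+D_{2i}w+\bar D_{2i}v_i,$$ and the observers, with given matrices $H_i$ and gains $K_i,L_i$, are, for $t\in[t_k,t_{k+1})$, $k=0,1,\dots$, $$\dot{\hat x}_i=A\hat x_i+L_i(y_i-C_i\hat x_i)+K_i\sum_{j\in\mathcal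 V_i}H_i\bigl(\hat x_j(t_{k-\nu_j+1})-\hat x_i(t_{k-\nu_j+1})\bigr),\qquad \hat x_i(t)=0\ (t\le0).$$ All differential equations are understood in the Carathéodory sense. Put $\xi_i=[w'\ v_i']'$, $B=[B_2\ 0]$, $D_i=[D_{2i}\ \bar D_{2i}]$. The errors $e_i=x-\hat x_i$ satisfy $$\dot e_i=(A-L_iC_i)e_i+(B-L_iD_i)\xi_i+K_iH_i\sum_{j\in\mathcal V_i}\bigl(e_j(t_{k-\nu_j+1})-e_i(t_{k-\nu_j+1})\bigr),\quad t\in[t_k,t_{k+1}).\tag{1}$$ **The problem.** Let $\gamma>0$. The gains $K_i,L_i$ *solve the distributed estimation problem with the weight $P=P'>0$* if (i) the system (1) with $\xi=0$ is exponentially stable: there are $c,\beta>0$ such that for every $m\ge0$, all vectors $\varphi_1,\dots,\varphi_N\in\mathbb R^n$ and every solution of (1) on $[t_m,\infty)$ with $\xi=0$ and $e_i(t)=\varphi_i$ for $t\le t_m$, $$\sum_i\|e_i(t)\|^2\le c\,e^{-2\beta (t-t_m)}\sum_i\|\varphi_i\|^2 ,\qquad t\ge t_m;$$ (ii) for all $x_0$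 and all $w,v_1,\dots,v_N\in L_2[0,\infty)$, $$J:=\frac1N\int_0^\infty\sum_{i=1}^N\sum_{j\in\mathcal V_i}\|\hat x_j-\hat x_i\|^2dt\ \le\ \gamma^2\Bigl(x_0'Px_0+\frac1N\sum_{i=1}^N\int_0^\infty\|\xi_i\|^2dt\Bigr)$$ (in particular $J<\infty$). **Matrices.** Given $Y_i,X_i,F_i,U_i,S_i,R_i,W_i,G_i$ and scalars $\alpha_i,\pi_i,\epsilon_i,\bar\epsilon_i$, let $\Psi_i$ be the matrix with $(p_i+1)\times(p_i+1)$ blocks of size $n\times n$, with diagonal blocks $R_i$ and all other blocks $\frac12(G_i+G_i')$. Let $T_i$ be the $(p_i+1)n\times(p_i+2)n$ matrix with $T_i\,[\bar e_0',\dots,\bar e_{p_i+1}']'=[(\bar e_0-\bar e_1)',\dots,(\bar e_{p_i}-\bar e_{p_i+1})']'$. Partition $\bar\Psi_i=e^{-2\alpha_i\tau_i}T_i'\Psi_iT_i$ into $3\times3$ blocks of sizes $n,\ p_in,\ n$. Let $\tilde\Psi_{i,11}=\bar\Psi_{i,11}-2\alpha_iY_i^{-1}-S_i$, $\tilde\Psi_{i,33}=\bar\Psi_{i,33}+e^{-2\alpha_i\tau_i}S_i$,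 and $\tilde\Psi_{i,\mu\nu}=\bar\Psi_{i,\mu\nu}$ otherwise. Let $\bar\Phi_{i,11}$ and $\bar\Phi_{i,22}$ be block-diagonal with the blocks $\pi_jY_j^{-1}+\frac{\pi^2}4W_j$ and $\frac{\pi^2}{4}W_j$, $j\in\mathcal V_i$, respectively ($\pi$ without index is the number $3.14\ldots$), and $\bar\Phi_{i,12}=-\bar\Phi_{i,22}$. Let $\bar\Xi_i$ be the symmetric matrix $$\bar\Xi_i=\begin{bmatrix} \bar\Xi_{aa}&\bar\Xi_{ab}&\bar\Xi_{ac}&0&0&\bar\Xi_{af}&\bar\Xi_{ag}\\ \star&\bar\Xi_{bb}&\bar\Xi_{bc}&-\tilde\Psi_{i,13}&\bar\Xi_{be}&\bar\Xi_{bf}&\bar\Xi_{bg}\\ \star&\star&-\tilde\Psi_{i,22}&-\tilde\Psi_{i,23}&0&\bar\Xi_{cf}&0\\ \star&\star&\star&-\tilde\Psi_{i,33}&0&0&0\\ \star&\star&\star&\star&-\bar\Phi_{i,11}&-\bar\Phi_{i,12}&0\\ \star&\star&\star&\star&\star&\bar\Xi_{ff}&\bar\Xi_{fg}\\ \star&\star&\star&\star&\star&\star&-I\end{bmatrix}$$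 where, with $\mathbf 1=\mathbf 1_{p_i}$, $$\begin{aligned} \bar\Xi_{aa}&=\tau_i^2R_i+\Bigl(\sum_{j:\,i\in\mathcal V_j}\tau_j^2\Bigr)W_i-\epsilon_iX_i-\epsilon_iX_i', & \bar\Xi_{ab}&=Y_i^{-1}-X_i+\epsilon_i(X_i'A-U_iC_i),\\ \bar\Xi_{ac}&=-\epsilon_i(\mathbf 1'\otimes F_iH_i), & \bar\Xi_{af}&=\mathbf 1'\otimes(-\bar\epsilon_iX_i+\epsilon_iF_iH_i),\\ \bar\Xi_{ag}&=\epsilon_i(X_i'B-U_iD_i), & \bar\Xi_{bb}&=\tfrac{p_i+q_i}{\gamma^2}I-\tilde\Psi_{i,11}+X_i'A-U_iC_i+A'X_i-C_i'U_i',\\ \bar\Xi_{bc}&=-\tilde\Psi_{i,12}-\mathbf 1'\otimes(F_iH_i), & \bar\Xi_{be}&=-\tfrac1{\gamma^2}(\mathbf 1'\otimes I),\\ \bar\Xi_{bf}&=\mathbf 1'\otimes(F_iH_i+\bar\epsilon_iA'X_i-\bar\epsilon_iC_i'U_i'), & \bar\Xi_{bg}&=X_i'B-U_iD_i,\\ \bar\Xi_{cf}&=-\mathbf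 1\mathbf 1'\otimes(\bar\epsilon_iH_i'F_i'), & \bar\Xi_{ff}&=\bar\epsilon_i\mathbf 1\mathbf 1'\otimes(F_iH_i+H_i'F_i')-\bar\Phi_{i,22},\\ \bar\Xi_{fg}&=\bar\epsilon_i\mathbf 1\otimes(X_i'B-U_iD_i). \end{aligned}$$ **Theorem.** Suppose there are matrices $Y_i=Y_i'>0$, $X_i$ with $\det X_i\ne0$, $F_i$, $U_i$, $S_i=S_i'\ge0$, $R_i=R_i'\ge0$, $W_i=W_i'\ge0$, $G_i$ and constants $\alpha_i>0$, $\pi_i\ge0$ with $q_i\pi_i<2\alpha_i$, $\epsilon_i>0$, $\bar\epsilon_i>0$ such that, for every $i=1,\dots,N$, $$\begin{bmatrix}R_i&G_i\\G_i'&R_i\end{bmatrix}\ge0\qquad\text{and}\qquad\bar\Xi_i<0 .$$ Then the network of observers with the gains $K_i=(X_i')^{-1}F_i$, $L_i=(X_i')^{-1}U_i$ solves the distributed estimation problem with level $\gamma$ and with the weight $$P=\frac1N\sum_{i=1}^N\Bigl(Y_i^{-1}+S_i\,\frac{1-e^{-2\alpha_i\tau_i}}{2\alpha_i}\Bigr).$$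 -/

import Mathlib

open Matrix MeasureTheory

noncomputable section

/-- The data of the estimation problem: a directed graph on the nodes `Fin N` without self-loops
(`Edge j i` is the edge from `j` to `i`), the plant, the sensors, the matrices `H i`, and the
sampling instants. -/
structure RRNetwork (N n mw mv : ℕ) (r h : Fin N → ℕ) where
  Edge : Fin N → Fin N → Prop
  loopless : ∀ i, ¬ Edge i i
  A : Matrix (Fin n) (Fin n) ℝ
  B₂ : Matrix (Fin n) (Fin mw) ℝ
  C : ∀ i, Matrix (Fin (r i)) (Fin n) ℝ
  D₂ : ∀ i, Matrix (Fin (r i)) (Fin mw) ℝ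
  Dbar₂ : ∀ i, Matrix (Fin (r i)) (Fin mv) ℝ
  H : ∀ i, Matrix (Fin (h i)) (Fin n) ℝ
  /-- The sampling instants. -/
  t : ℕ → ℝ
  t_zero : t 0 = 0
  t_strictMono : StrictMono t
  t_tendsto : Filter.Tendsto t Filter.atTop Filter.atTop

namespace RRNetwork

variable {N n mw mv : ℕ} {r h : Fin N → ℕ} (net : RRNetwork N n mw mv r h)

/-! ### Graph and schedule -/

open Classical in
/-- The neighbourhood of `i`: the nodes that supply information to `i`. -/
def nbr (i : Fin N) : Finset (Fin N) := Finset.univ.filter fun j => net.Edge j i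

open Classical in
/-- The nodes that receive information from `i`. -/
def outNbr (i : Fin N) : Finset (Fin N) := Finset.univ.filter fun j => net.Edge i j

/-- The in-degree. -/
def p (i : Fin N) : ℕ := (net.nbr i).card

/-- The out-degree. -/
def q (i : Fin N) : ℕ := (net.outNbr i).card

/-- The shift permutation `{j₁, …, j_{p-1}, j_p} ↦ {j_p, j₁, …, j_{p-1}}`. -/
def shift {α : Type*} (l : List α) : List α := l.rotate (l.length - 1)

/-- The neighbourhood of `i` in ascending order, shifted `k` times. -/
def polling (i : Fin N) (k : ℕ) : List (Fin N) := shift^[k] ((net.nbr i).sort (· ≤ ·))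

/-- The position, in `{1, …, p i}`, of the neighbour `j` in the `k`-th shifted neighbourhood. -/
def ν (i : Fin N) (k : ℕ) (j : Fin N) : ℕ := (net.polling i k).idxOf j + 1

/-- The instant `t_{k - ν_j + 1}` of the sample from channel `(j, i)` that is in use on
`[t_k, t_{k+1})`. If the index would be negative (the channel has not been polled yet), the
truncated subtraction gives `t₀ = 0`, where all signals still have their initial values. -/
def sampleTime (i : Fin N) (k : ℕ) (j : Fin N) : ℝ := net.t (k + 1 - net.ν i k j)

/-- The times `t_{k+1} - t_{k-p_i+1}` between two consecutive polls of a channel of node `i`.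
For `k + 1 < p i` the truncated subtraction gives `t_{k+1} - t_0`, which does not exceed the value
`t_{p i} - t_0` at `k = p i - 1`. -/
def pollGap (i : Fin N) (k : ℕ) : ℝ := net.t (k + 1) - net.t (k + 1 - net.p i)

/-- The maximal delay `τ_i`. -/
def τ (i : Fin N) : ℝ := ⨆ k, net.pollGap i k

/-! ### Plant, observers, estimation errors -/

/-- `x` solves `ẋ = A x + B₂ w`, `x(s) = x₀` for `s ≤ 0` (in the sense of Carathéodory). -/
def IsPlantTrajectory (x₀ : Fin n → ℝ) (w : ℝ → Fin mw → ℝ) (x : ℝ → Fin n → ℝ) : Prop :=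
  Continuous x ∧ (∀ s ≤ 0, x s = x₀) ∧
    ∀ s, 0 ≤ s → x s = x₀ + ∫ u in (0 : ℝ)..s, (net.A *ᵥ x u + net.B₂ *ᵥ w u)

/-- The measurement of node `i`. -/
def y (x : ℝ → Fin n → ℝ) (w : ℝ → Fin mw → ℝ) (v : Fin N → ℝ → Fin mv → ℝ) (i : Fin N) (s : ℝ) :
    Fin (r i) → ℝ :=
  net.C i *ᵥ x s + net.D₂ i *ᵥ w s + net.Dbar₂ i *ᵥ v i s

/-- `xh` solves the observer equations under the Round-Robin protocol with gains `K`, `L`, with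
zero initial conditions, driven by the measurements `y`. -/
def IsObserverTrajectory (K : ∀ i, Matrix (Fin n) (Fin (h i)) ℝ)
    (L : ∀ i, Matrix (Fin n) (Fin (r i)) ℝ) (y : ∀ i, ℝ → Fin (r i) → ℝ)
    (xh : Fin N → ℝ → Fin n → ℝ) : Prop :=
  (∀ i, Continuous (xh i)) ∧ (∀ i, ∀ s ≤ 0, xh i s = 0) ∧
    ∀ i k, ∀ s ∈ Set.Icc (net.t k) (net.t (k + 1)),
      xh i s = xh i (net.t k) + ∫ u in (net.t k)..s,
        (net.A *ᵥ xh i u + L i *ᵥ (y i u - net.C i *ᵥ xh i u) +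
          K i *ᵥ ∑ j ∈ net.nbr i,
            net.H i *ᵥ (xh j (net.sampleTime i k j) - xh i (net.sampleTime i k j)))

/-- `B = [B₂ 0]`. -/
def B : Matrix (Fin n) (Fin mw ⊕ Fin mv) ℝ := fromCols net.B₂ 0

/-- `D_i = [D_{2i} D̄_{2i}]`. -/
def D (i : Fin N) : Matrix (Fin (r i)) (Fin mw ⊕ Fin mv) ℝ := fromCols (net.D₂ i) (net.Dbar₂ i)

/-- `e` solves the interconnected error equations, started at the sampling instant `t_m` with
`e_i(s) = φ_i` for all `s ≤ t_m`, and perturbed by `ξ`. -/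
def IsErrorTrajectory (K : ∀ i, Matrix (Fin n) (Fin (h i)) ℝ)
    (L : ∀ i, Matrix (Fin n) (Fin (r i)) ℝ) (ξ : Fin N → ℝ → (Fin mw ⊕ Fin mv) → ℝ)
    (m : ℕ) (φ : Fin N → Fin n → ℝ) (e : Fin N → ℝ → Fin n → ℝ) : Prop :=
  (∀ i, Continuous (e i)) ∧ (∀ i, ∀ s ≤ net.t m, e i s = φ i) ∧
    ∀ i, ∀ k ≥ m, ∀ s ∈ Set.Icc (net.t k) (net.t (k + 1)),
      e i s = e i (net.t k) + ∫ u in (net.t k)..s,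
        ((net.A - L i * net.C i) *ᵥ e i u + (net.B - L i * net.D i) *ᵥ ξ i u +
          (K i * net.H i) *ᵥ ∑ j ∈ net.nbr i,
            (e j (net.sampleTime i k j) - e i (net.sampleTime i k j)))

/-- Exponential stability of the unperturbed interconnected error system, uniform in the sampling
instant at which it is started; the initial values at the nodes are arbitrary.
Here `z ⬝ᵥ z` is the squared Euclidean norm. -/
def ExponentiallyStable (K : ∀ i, Matrix (Fin n) (Fin (h i)) ℝ)
    (L : ∀ i, Matrix (Fin n) (Fin (r i)) ℝ) : Prop :=
  ∃ c > 0, ∃ β > 0, ∀ (m : ℕ) (φ : Fin N → Fin n → ℝ) (e : Fin N → ℝ → Fin n → ℝ),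
    net.IsErrorTrajectory K L (fun _ _ => 0) m φ e → ∀ s ≥ net.t m,
      ∑ i, e i s ⬝ᵥ e i s ≤ c * Real.exp (-2 * β * (s - net.t m)) * ∑ i, φ i ⬝ᵥ φ i

/-- The integrand of the cost of disagreement. -/
def disagreement (xh : Fin N → ℝ → Fin n → ℝ) (s : ℝ) : ℝ :=
  ∑ i, ∑ j ∈ net.nbr i, (xh j s - xh i s) ⬝ᵥ (xh j s - xh i s)

/-- The consensus performance level `γ` with the weight `P`: for all initial states `x₀` and all
square integrable disturbances, the cost `J` of disagreement is finite and
`J ≤ γ² (x₀' P x₀ + (1/N) ∑ᵢ ∫ ‖ξᵢ‖²)`, where `ξᵢ = [w' vᵢ']'`. -/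
def ConsensusPerformance (K : ∀ i, Matrix (Fin n) (Fin (h i)) ℝ)
    (L : ∀ i, Matrix (Fin n) (Fin (r i)) ℝ) (γ : ℝ) (P : Matrix (Fin n) (Fin n) ℝ) : Prop :=
  ∀ (x₀ : Fin n → ℝ) (w : ℝ → Fin mw → ℝ) (v : Fin N → ℝ → Fin mv → ℝ)
    (x : ℝ → Fin n → ℝ) (xh : Fin N → ℝ → Fin n → ℝ),
    MemLp w 2 (volume.restrict (Set.Ioi 0)) →
    (∀ i, MemLp (v i) 2 (volume.restrict (Set.Ioi 0))) →
    net.IsPlantTrajectory x₀ w x →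
    net.IsObserverTrajectory K L (net.y x w v) xh →
      IntegrableOn (net.disagreement xh) (Set.Ioi 0) ∧
      (1 / (N : ℝ)) * ∫ s in Set.Ioi (0 : ℝ), net.disagreement xh s ≤
        γ ^ 2 * (x₀ ⬝ᵥ (P *ᵥ x₀) +
          (1 / (N : ℝ)) * ∑ i, ∫ s in Set.Ioi (0 : ℝ), (w s ⬝ᵥ w s + v i s ⬝ᵥ v i s))

/-- The gains `K`, `L` solve the distributed estimation problem with level `γ` and weight `P`. -/
def SolvesEstimationProblem (K : ∀ i, Matrix (Fin n) (Fin (h i)) ℝ)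
    (L : ∀ i, Matrix (Fin n) (Fin (r i)) ℝ) (γ : ℝ) (P : Matrix (Fin n) (Fin n) ℝ) : Prop :=
  net.ExponentiallyStable K L ∧ P.PosDef ∧ net.ConsensusPerformance K L γ P

end RRNetwork

/-! ### Block matrices -/

namespace RRBlock

/-- `𝟏' ⊗ M`. -/
def oneRow (ι : Type*) {α β : Type*} (M : Matrix α β ℝ) : Matrix α (ι × β) ℝ :=
  of fun a b => M a b.2

/-- `𝟏 ⊗ M`. -/
def oneCol (ι : Type*) {α β : Type*} (M : Matrix α β ℝ) : Matrix (ι × α) β ℝ :=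
  of fun a b => M a.2 b

/-- `𝟏 𝟏' ⊗ M`. -/
def oneFull (ι κ : Type*) {α β : Type*} (M : Matrix α β ℝ) : Matrix (ι × α) (κ × β) ℝ :=
  of fun a b => M a.2 b.2

/-- The block-diagonal matrix with diagonal blocks `M j`. -/
def blkDiag {ι α : Type*} [DecidableEq ι] (M : ι → Matrix α α ℝ) : Matrix (ι × α) (ι × α) ℝ :=
  of fun a b => if a.1 = b.1 then M a.1 a.2 b.2 else 0

/-- The symmetric block matrix with upper triangle `M₁₁`, `M₁₂`, `M₂₂`. -/
def sym {α β : Type*} (M₁₁ : Matrix α α ℝ) (M₁₂ : Matrix α β ℝ) (M₂₂ : Matrix β β ℝ) :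
    Matrix (α ⊕ β) (α ⊕ β) ℝ :=
  fromBlocks M₁₁ M₁₂ M₁₂ᵀ M₂₂

/-- `Ψ`: `p + 1` diagonal blocks `R`, all other blocks `(G + G') / 2`. -/
def Psi {n : ℕ} (p : ℕ) (R G : Matrix (Fin n) (Fin n) ℝ) :
    Matrix (Fin (p + 1) × Fin n) (Fin (p + 1) × Fin n) ℝ :=
  of fun a b => if a.1 = b.1 then R a.2 b.2 else ((1 / 2 : ℝ) • (G + Gᵀ)) a.2 b.2

/-- `T`: maps `(ē_0, …, ē_{p+1})` to its successive differences `δ_ν = ē_ν - ē_{ν+1}`,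
`ν = 0, …, p`. It is applied to `ē = (e(t), e(t_k), …, e(t_{k-p+1}), e(t-τ))`. -/
def T (n p : ℕ) : Matrix (Fin (p + 1) × Fin n) (Fin (p + 2) × Fin n) ℝ :=
  of fun a b => ((if b.1 = a.1.castSucc then 1 else 0) - (if b.1 = a.1.succ then 1 else 0)) *
    (1 : Matrix (Fin n) (Fin n) ℝ) a.2 b.2

/-- `Ψ̄ = e^{-2ατ} T' Ψ T`. -/
def PsiBar {n : ℕ} (p : ℕ) (R G : Matrix (Fin n) (Fin n) ℝ) (α τ : ℝ) :
    Matrix (Fin (p + 2) × Fin n) (Fin (p + 2) × Fin n) ℝ :=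
  Real.exp (-2 * α * τ) • ((T n p)ᵀ * Psi p R G * T n p)

/-- The first block of the partition of `ē`, that is `e(t)`. -/
def i₁ {n : ℕ} (p : ℕ) (a : Fin n) : Fin (p + 2) × Fin n := (0, a)

/-- The middle block of the partition of `ē`, that is the `p` samples. -/
def i₂ {n : ℕ} (p : ℕ) (a : Fin p × Fin n) : Fin (p + 2) × Fin n := (a.1.succ.castSucc, a.2)

/-- The last block of the partition of `ē`, that is `e(t-τ)`. -/
def i₃ {n : ℕ} (p : ℕ) (a : Fin n) : Fin (p + 2) × Fin n := (Fin.last (p + 1), a)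

end RRBlock

/-- The decision variables of the synthesis conditions; `pi i` is the scalar `π_i`. -/
structure RRDesign (N n : ℕ) (r h : Fin N → ℕ) where
  Y : Fin N → Matrix (Fin n) (Fin n) ℝ
  X : Fin N → Matrix (Fin n) (Fin n) ℝ
  F : ∀ i, Matrix (Fin n) (Fin (h i)) ℝ
  U : ∀ i, Matrix (Fin n) (Fin (r i)) ℝ
  S : Fin N → Matrix (Fin n) (Fin n) ℝ
  R : Fin N → Matrix (Fin n) (Fin n) ℝ
  W : Fin N → Matrix (Fin n) (Fin n) ℝ
  G : Fin N → Matrix (Fin n) (Fin n) ℝ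
  α : Fin N → ℝ
  pi : Fin N → ℝ
  ε : Fin N → ℝ
  εbar : Fin N → ℝ

namespace RRDesign

open RRBlock

variable {N n mw mv : ℕ} {r h : Fin N → ℕ} (d : RRDesign N n r h) (net : RRNetwork N n mw mv r h)

/-- The interconnection gains `K_i = (X_i')⁻¹ F_i`. -/
def K (i : Fin N) : Matrix (Fin n) (Fin (h i)) ℝ := ((d.X i)ᵀ)⁻¹ * d.F i

/-- The observer gains `L_i = (X_i')⁻¹ U_i`. -/
def L (i : Fin N) : Matrix (Fin n) (Fin (r i)) ℝ := ((d.X i)ᵀ)⁻¹ * d.U i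

/-- `P = (1/N) ∑ᵢ (Y_i⁻¹ + S_i (1 - e^{-2 α_i τ_i}) / (2 α_i))`. -/
def P : Matrix (Fin n) (Fin n) ℝ :=
  (1 / (N : ℝ)) • ∑ i, ((d.Y i)⁻¹ +
    ((1 - Real.exp (-2 * d.α i * net.τ i)) / (2 * d.α i)) • d.S i)

/-- The matrix `Ψ̄_i`. -/
def PsiBar (i : Fin N) : Matrix (Fin (net.p i + 2) × Fin n) (Fin (net.p i + 2) × Fin n) ℝ :=
  RRBlock.PsiBar (net.p i) (d.R i) (d.G i) (d.α i) (net.τ i)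

/-! The blocks of `Ψ̃_i`. -/

def PsiT₁₁ (i : Fin N) : Matrix (Fin n) (Fin n) ℝ :=
  (d.PsiBar net i).submatrix (i₁ _) (i₁ _) - (2 * d.α i) • (d.Y i)⁻¹ - d.S i

def PsiT₁₂ (i : Fin N) : Matrix (Fin n) (Fin (net.p i) × Fin n) ℝ :=
  (d.PsiBar net i).submatrix (i₁ _) (i₂ _)

def PsiT₁₃ (i : Fin N) : Matrix (Fin n) (Fin n) ℝ :=
  (d.PsiBar net i).submatrix (i₁ _) (i₃ _)

def PsiT₂₂ (i : Fin N) : Matrix (Fin (net.p i) × Fin n) (Fin (net.p i) × Fin n) ℝ :=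
  (d.PsiBar net i).submatrix (i₂ _) (i₂ _)

def PsiT₂₃ (i : Fin N) : Matrix (Fin (net.p i) × Fin n) (Fin n) ℝ :=
  (d.PsiBar net i).submatrix (i₂ _) (i₃ _)

def PsiT₃₃ (i : Fin N) : Matrix (Fin n) (Fin n) ℝ :=
  (d.PsiBar net i).submatrix (i₃ _) (i₃ _) + Real.exp (-2 * d.α i * net.τ i) • d.S i

/-! The blocks of `Φ̄_i`; they are indexed by the neighbours of `i`. -/

def Phi₁₁ (i : Fin N) : Matrix (net.nbr i × Fin n) (net.nbr i × Fin n) ℝ :=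
  blkDiag fun j : net.nbr i => d.pi j • (d.Y j)⁻¹ + (Real.pi ^ 2 / 4) • d.W j

def Phi₂₂ (i : Fin N) : Matrix (net.nbr i × Fin n) (net.nbr i × Fin n) ℝ :=
  blkDiag fun j : net.nbr i => (Real.pi ^ 2 / 4) • d.W j

def Phi₁₂ (i : Fin N) : Matrix (net.nbr i × Fin n) (net.nbr i × Fin n) ℝ := - d.Phi₂₂ net i

/-! The blocks of `Ξ̄_i` that are not blocks of `Ψ̃_i` or `Φ̄_i`. -/

def Xi_aa (i : Fin N) : Matrix (Fin n) (Fin n) ℝ :=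
  net.τ i ^ 2 • d.R i + (∑ j ∈ net.outNbr i, net.τ j ^ 2) • d.W i
    - d.ε i • d.X i - d.ε i • (d.X i)ᵀ

def Xi_ab (i : Fin N) : Matrix (Fin n) (Fin n) ℝ :=
  (d.Y i)⁻¹ - d.X i + d.ε i • ((d.X i)ᵀ * net.A - d.U i * net.C i)

def Xi_ac (i : Fin N) : Matrix (Fin n) (Fin (net.p i) × Fin n) ℝ :=
  - d.ε i • oneRow (Fin (net.p i)) (d.F i * net.H i)

def Xi_af (i : Fin N) : Matrix (Fin n) (net.nbr i × Fin n) ℝ :=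
  oneRow (net.nbr i) (- d.εbar i • d.X i + d.ε i • (d.F i * net.H i))

def Xi_ag (i : Fin N) : Matrix (Fin n) (Fin mw ⊕ Fin mv) ℝ :=
  d.ε i • ((d.X i)ᵀ * net.B - d.U i * net.D i)

def Xi_bb (γ : ℝ) (i : Fin N) : Matrix (Fin n) (Fin n) ℝ :=
  (((net.p i : ℝ) + (net.q i : ℝ)) / γ ^ 2) • (1 : Matrix (Fin n) (Fin n) ℝ) - d.PsiT₁₁ net i
    + ((d.X i)ᵀ * net.A - d.U i * net.C i + net.Aᵀ * d.X i - (net.C i)ᵀ * (d.U i)ᵀ)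

def Xi_bc (i : Fin N) : Matrix (Fin n) (Fin (net.p i) × Fin n) ℝ :=
  - d.PsiT₁₂ net i - oneRow (Fin (net.p i)) (d.F i * net.H i)

def Xi_be (γ : ℝ) (i : Fin N) : Matrix (Fin n) (net.nbr i × Fin n) ℝ :=
  - (1 / γ ^ 2) • oneRow (net.nbr i) (1 : Matrix (Fin n) (Fin n) ℝ)

def Xi_bf (i : Fin N) : Matrix (Fin n) (net.nbr i × Fin n) ℝ :=
  oneRow (net.nbr i) (d.F i * net.H i + d.εbar i • (net.Aᵀ * d.X i)
    - d.εbar i • ((net.C i)ᵀ * (d.U i)ᵀ))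

def Xi_bg (i : Fin N) : Matrix (Fin n) (Fin mw ⊕ Fin mv) ℝ :=
  (d.X i)ᵀ * net.B - d.U i * net.D i

def Xi_cf (i : Fin N) : Matrix (Fin (net.p i) × Fin n) (net.nbr i × Fin n) ℝ :=
  - oneFull (Fin (net.p i)) (net.nbr i) (d.εbar i • ((net.H i)ᵀ * (d.F i)ᵀ))

def Xi_ff (i : Fin N) : Matrix (net.nbr i × Fin n) (net.nbr i × Fin n) ℝ :=
  d.εbar i • oneFull (net.nbr i) (net.nbr i) (d.F i * net.H i + (net.H i)ᵀ * (d.F i)ᵀ)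
    - d.Phi₂₂ net i

def Xi_fg (i : Fin N) : Matrix (net.nbr i × Fin n) (Fin mw ⊕ Fin mv) ℝ :=
  d.εbar i • oneCol (net.nbr i) ((d.X i)ᵀ * net.B - d.U i * net.D i)

/-- The matrix `Ξ̄_i`, with seven block rows `a, …, g`, given by its upper triangle. -/
def Xi (γ : ℝ) (i : Fin N) :
    let ι := Fin n ⊕ Fin n ⊕ (Fin (net.p i) × Fin n) ⊕ Fin n ⊕ (net.nbr i × Fin n) ⊕
      (net.nbr i × Fin n) ⊕ (Fin mw ⊕ Fin mv)
    Matrix ι ι ℝ :=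
  sym (d.Xi_aa net i) (fromCols (d.Xi_ab net i) (fromCols (d.Xi_ac net i) (fromCols 0
        (fromCols 0 (fromCols (d.Xi_af net i) (d.Xi_ag net i)))))) <|
  sym (d.Xi_bb net γ i) (fromCols (d.Xi_bc net i) (fromCols (- d.PsiT₁₃ net i)
        (fromCols (Xi_be net γ i) (fromCols (d.Xi_bf net i) (d.Xi_bg net i))))) <|
  sym (- d.PsiT₂₂ net i) (fromCols (- d.PsiT₂₃ net i) (fromCols 0
        (fromCols (d.Xi_cf net i) 0))) <|
  sym (- d.PsiT₃₃ net i) (fromCols 0 (fromCols 0 0)) <|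
  sym (- d.Phi₁₁ net i) (fromCols (- d.Phi₁₂ net i) 0) <|
  sym (d.Xi_ff net i) (d.Xi_fg net i) (-1)

/-- The hypotheses of the synthesis result. The condition `π_i < 2 α_i / q_i` is written as
`q_i π_i < 2 α_i`, so that it is void if `q_i = 0`. -/
def Feasible (γ : ℝ) : Prop :=
  ∀ i, (d.Y i).PosDef ∧ (d.X i).det ≠ 0 ∧ (d.S i).PosSemidef ∧ (d.R i).PosSemidef ∧
    (d.W i).PosSemidef ∧ 0 < d.α i ∧ 0 ≤ d.pi i ∧ (net.q i : ℝ) * d.pi i < 2 * d.α i ∧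
    0 < d.ε i ∧ 0 < d.εbar i ∧
    (fromBlocks (d.R i) (d.G i) (d.G i)ᵀ (d.R i)).PosSemidef ∧
    (- d.Xi net γ i).PosDef

end RRDesign

end

/-! The matrix inequality is a dissipation inequality in descriptor form. Evaluate the form of
`Ξ̄_i` at (ė_i, e_i, own samples, e_i(t-τ_i), neighbours' errors, neighbours' held samples, ξ_i).
The error equation multiplied by e_i + ε_i ė_i + ε̄_i Σ_j (held e_j) contributes zero, and this
eliminates X_i, F_i, U_i (`RRDesign.Xi_quadratic`). There remain the derivative of V_i =
e_i'Y_i⁻¹e_i, the term 2α_i V_i, a share of the disagreement, -‖ξ_i‖², and delay terms with R_i, S_i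
and W_j. Negative definiteness bounds their sum by -δ_i(‖e_i‖² + ‖ė_i‖²) for some δ_i > 0.

No Lyapunov-Krasovskii functional is differentiated: the delay terms are integrated directly against
e^{2βt}, from a start t_m before which all errors are constant. - R: Jensen's inequality combined
with reciprocal convexity bounds the `Ψ̄_i` form by e^{-2α_iτ_i} τ_i ∫ ė_i'R_iė_i over the last τ_i
time units (`HasL2Deriv.reciprocally_convex`). Integrated in time, this is covered by τ_i²
ė_i'R_iė_i. - S: the delayed and undelayed terms cancel by a shift of time, up to a cost of the
constant initial history (`integral_weighted_sub_delay_ge`). - W: between two polls of a channel the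
deviation from the held sample starts at zero, so Wirtinger's inequality with constant π²/4 bounds
it by the derivative (`HasL2Deriv.wirtinger`, `RRNetwork.integral_held_nonneg`).

Summation over the nodes, with edges reindexed by their source, matches the coupling terms: q_iπ_i
against 2α_i, the W_i-terms against Σ τ_j² over out-neighbours, and p_i + q_i against the
disagreement. The result is `RRDesign.energy_le`. With β = 0 and δ = 0 it yields the performance
bound. For exponential stability β > 0 is chosen so small that δ_i absorbs the errors caused by the
weight. -/

/-! ### Calculus of primitives of locally square integrable functions -/

open Set intervalIntegral in
theorem AbsolutelyContinuousOnInterval.integral_eq_sub_of_ae_hasDerivAt {f f' : ℝ → ℝ} {a b : ℝ}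
    (hf : AbsolutelyContinuousOnInterval f a b)
    (h : ∀ᵐ x, x ∈ uIcc a b → HasDerivAt f (f' x) x) :
    ∫ x in a..b, f' x = f b - f a := by
  rw [← hf.integral_deriv_eq_sub]
  refine integral_congr_ae ?_
  filter_upwards [h] with x hx hxm
  exact (hx (uIoc_subset_uIcc hxm)).deriv.symm

theorem absolutelyContinuousOnInterval_of_hasDerivAt {f f' : ℝ → ℝ} {a b : ℝ}
    (h : ∀ x ∈ Set.uIcc a b, HasDerivAt f (f' x) x) (hc : ContinuousOn f' (Set.uIcc a b)) :
    AbsolutelyContinuousOnInterval f a b := by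
  obtain ⟨C, hC⟩ := isCompact_uIcc.exists_bound_of_continuousOn hc
  refine LipschitzOnWith.absolutelyContinuousOnInterval (K := C.toNNReal) ?_
  refine (convex_uIcc a b).lipschitzOnWith_of_nnnorm_hasDerivWithin_le
    (fun x hx => (h x hx).hasDerivWithinAt) fun x hx => ?_
  rw [← NNReal.coe_le_coe, coe_nnnorm]
  exact (hC x hx).trans (Real.le_coe_toNNReal C)

theorem IntervalIntegrable.fun_finsetSum {κ : Type*} {s : Finset κ} {f : κ → ℝ → ℝ} {a b : ℝ}
    (h : ∀ i ∈ s, IntervalIntegrable (f i) volume a b) :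
    IntervalIntegrable (fun u => ∑ i ∈ s, f i u) volume a b := by
  simpa only [Finset.sum_fn] using IntervalIntegrable.sum s h

theorem intervalIntegrable_quadratic_of_memLp {ι : Type*} [Fintype ι] {f : ℝ → ι → ℝ} {a b : ℝ}
    (hf : ∀ c, MemLp (fun u => f u c) 2 (volume.restrict (Set.uIoc a b))) (Q : Matrix ι ι ℝ) :
    IntervalIntegrable (fun u => f u ⬝ᵥ (Q *ᵥ f u)) volume a b := by
  simp only [dotProduct, mulVec, Finset.mul_sum]
  refine IntervalIntegrable.fun_finsetSum fun c _ => IntervalIntegrable.fun_finsetSum fun c' _ => ?_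
  have h : IntervalIntegrable (fun u => f u c * f u c') volume a b :=
    intervalIntegrable_iff.2 ((hf c).integrable_mul (hf c'))
  convert! h.const_mul (Q c c') using 2
  ring

/-- `e` is a primitive of the locally square integrable function `g`. -/
structure HasL2Deriv {ι : Type*} (e g : ℝ → ι → ℝ) : Prop where
  memLp : ∀ c a b, MemLp (fun u => g u c) 2 (volume.restrict (Set.Ioc a b))
  eq : ∀ a b c, e b c - e a c = ∫ u in a..b, g u c

namespace HasL2Deriv

variable {ι : Type*} {e g : ℝ → ι → ℝ}

theorem intervalIntegrable (hp : HasL2Deriv e g) (c : ι) (a b : ℝ) :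
    IntervalIntegrable (fun u => g u c) volume a b :=
  ⟨(hp.memLp c a b).integrable (by norm_num), (hp.memLp c b a).integrable (by norm_num)⟩

theorem eq_add (hp : HasL2Deriv e g) (a : ℝ) (c : ι) :
    (fun u => e u c) = fun u => e a c + ∫ s in a..u, g s c := by
  funext u
  rw [← hp.eq a u c]; ring

theorem absolutelyContinuous (hp : HasL2Deriv e g) (c : ι) (a b : ℝ) :
    AbsolutelyContinuousOnInterval (fun u => e u c) a b := by
  rw [hp.eq_add a c]
  exact (absolutelyContinuousOnInterval_of_hasDerivAt (f' := fun _ => 0)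
    (fun x _ => hasDerivAt_const x (e a c)) continuousOn_const).add
    ((hp.intervalIntegrable c a b).absolutelyContinuousOnInterval_intervalIntegral (by simp))

theorem ae_hasDerivAt (hp : HasL2Deriv e g) (c : ι) (a b : ℝ) :
    ∀ᵐ x, x ∈ Set.uIcc a b → HasDerivAt (fun u => e u c) (g x c) x := by
  filter_upwards [(hp.intervalIntegrable c a b).ae_hasDerivAt_integral] with x hx hxm
  rw [hp.eq_add a c]
  exact (hx hxm a (by simp)).const_add _

theorem continuous_apply (hp : HasL2Deriv e g) (c : ι) : Continuous fun u => e u c := by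
  rw [hp.eq_add 0 c]
  exact continuous_const.add (intervalIntegral.continuous_primitive
    (fun a b => hp.intervalIntegrable c a b) 0)

theorem continuous (hp : HasL2Deriv e g) : Continuous e :=
  continuous_pi fun c => hp.continuous_apply c

theorem sub_const (hp : HasL2Deriv e g) (v : ι → ℝ) : HasL2Deriv (fun u => e u - v) g :=
  ⟨hp.memLp, fun a b c => by rw [← hp.eq a b c]; simp⟩

variable [Fintype ι]

theorem intervalIntegrable_quadratic (hp : HasL2Deriv e g) (Q : Matrix ι ι ℝ) (a b : ℝ) :
    IntervalIntegrable (fun u => g u ⬝ᵥ (Q *ᵥ g u)) volume a b :=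
  intervalIntegrable_quadratic_of_memLp (fun c => hp.memLp c _ _) Q

theorem intervalIntegrable_dotProduct (hp : HasL2Deriv e g) (v : ι → ℝ) (a b : ℝ) :
    IntervalIntegrable (fun u => v ⬝ᵥ g u) volume a b := by
  simp only [dotProduct]
  exact IntervalIntegrable.fun_finsetSum fun c _ => (hp.intervalIntegrable c a b).const_mul _

theorem integral_dotProduct (hp : HasL2Deriv e g) (v : ι → ℝ) (a b : ℝ) :
    ∫ u in a..b, v ⬝ᵥ g u = v ⬝ᵥ (e b - e a) := by
  simp only [dotProduct]
  rw [intervalIntegral.integral_finsetSum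
    fun c _ => (hp.intervalIntegrable c a b).const_mul _]
  exact Finset.sum_congr rfl fun c _ => by
    rw [intervalIntegral.integral_const_mul, ← hp.eq a b c, Pi.sub_apply]

theorem intervalIntegrable_bilinear (hp : HasL2Deriv e g) (Q : Matrix ι ι ℝ) {f : ℝ → ι → ℝ}
    (hf : Continuous f) (a b : ℝ) :
    IntervalIntegrable (fun u => f u ⬝ᵥ (Q *ᵥ g u)) volume a b := by
  simp only [dotProduct, mulVec, Finset.mul_sum]
  refine IntervalIntegrable.fun_finsetSum fun c _ => IntervalIntegrable.fun_finsetSum fun c' _ => ?_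
  refine IntervalIntegrable.continuousOn_mul ?_ (by fun_prop)
  exact (hp.intervalIntegrable c' a b).const_mul _

/-- The fundamental theorem of calculus for a weighted quadratic form of an absolutely continuous
function. -/
theorem integral_weighted_quadratic (hp : HasL2Deriv e g) {Q : Matrix ι ι ℝ} (hQ : Qᵀ = Q)
    {φ φ' : ℝ → ℝ} {a b : ℝ} (hφ : ∀ x ∈ Set.uIcc a b, HasDerivAt φ (φ' x) x)
    (hφ' : ContinuousOn φ' (Set.uIcc a b)) :
    ∫ u in a..b, (φ' u * (e u ⬝ᵥ (Q *ᵥ e u)) + φ u * (2 * (e u ⬝ᵥ (Q *ᵥ g u)))) =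
      φ b * (e b ⬝ᵥ (Q *ᵥ e b)) - φ a * (e a ⬝ᵥ (Q *ᵥ e a)) := by
  have hsum : ∀ x y : ι → ℝ, x ⬝ᵥ (Q *ᵥ y) = ∑ c, ∑ c', Q c c' * (x c * y c') := by
    intro x y
    simp only [dotProduct, mulVec, Finset.mul_sum]
    exact Finset.sum_congr rfl fun c _ => Finset.sum_congr rfl fun c' _ => by ring
  have hsym : ∀ x y : ι → ℝ, 2 * (x ⬝ᵥ (Q *ᵥ y)) =
      ∑ c, ∑ c', Q c c' * (y c * x c' + x c * y c') := by
    intro x y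
    have : y ⬝ᵥ (Q *ᵥ x) = x ⬝ᵥ (Q *ᵥ y) := by
      rw [dotProduct_mulVec, ← mulVec_transpose, hQ, dotProduct_comm]
    rw [two_mul]
    nth_rewrite 1 [← this]
    rw [hsum, hsum]
    simp only [mul_add, Finset.sum_add_distrib]
  -- Each entry φ e_c e_c' is a product of absolutely continuous functions, so it is the integral of
  -- its almost-everywhere derivative. The quadratic form is a finite combination of such entries.
  have hterm : ∀ c c' : ι,
      ∫ u in a..b, (φ' u * (e u c * e u c') + φ u * (g u c * e u c' + e u c * g u c')) =
        φ b * (e b c * e b c') - φ a * (e a c * e a c') := by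
    intro c c'
    refine AbsolutelyContinuousOnInterval.integral_eq_sub_of_ae_hasDerivAt
      (f := fun u => φ u * (e u c * e u c')) ?_ ?_
    · exact (absolutelyContinuousOnInterval_of_hasDerivAt hφ hφ').fun_mul
        ((hp.absolutelyContinuous c a b).fun_mul (hp.absolutelyContinuous c' a b))
    · filter_upwards [hp.ae_hasDerivAt c a b, hp.ae_hasDerivAt c' a b] with x h1 h2 hx
      exact (hφ x hx).mul ((h1 hx).mul (h2 hx))
  have hφc : ContinuousOn φ (Set.uIcc a b) := fun x hx => (hφ x hx).continuousAt.continuousWithinAt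
  have hint : ∀ c c' : ι, IntervalIntegrable (fun u => Q c c' *
      (φ' u * (e u c * e u c') + φ u * (g u c * e u c' + e u c * g u c'))) volume a b := by
    intro c c'
    have h1 := hp.continuous_apply c
    have h2 := hp.continuous_apply c'
    refine IntervalIntegrable.const_mul (IntervalIntegrable.add ?_ ?_) _
    · exact (hφ'.mul (h1.mul h2).continuousOn).intervalIntegrable
    · refine IntervalIntegrable.continuousOn_mul (IntervalIntegrable.add ?_ ?_) hφc
      · exact (hp.intervalIntegrable c a b).mul_continuousOn h2.continuousOn
      · exact (hp.intervalIntegrable c' a b).continuousOn_mul h1.continuousOn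
  calc _ = ∫ u in a..b, ∑ c, ∑ c', Q c c' *
        (φ' u * (e u c * e u c') + φ u * (g u c * e u c' + e u c * g u c')) := by
        refine intervalIntegral.integral_congr fun u _ => ?_
        simp only [hsum (e u) (e u), hsym (e u) (g u), Finset.mul_sum, ← Finset.sum_add_distrib]
        exact Finset.sum_congr rfl fun c _ => Finset.sum_congr rfl fun c' _ => by ring
    _ = ∑ c, ∑ c', Q c c' * (φ b * (e b c * e b c') - φ a * (e a c * e a c')) := by
        rw [intervalIntegral.integral_finsetSum
          fun c _ => IntervalIntegrable.fun_finsetSum fun c' _ => hint c c']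
        refine Finset.sum_congr rfl fun c _ => ?_
        rw [intervalIntegral.integral_finsetSum fun c' _ => hint c c']
        refine Finset.sum_congr rfl fun c' _ => ?_
        rw [intervalIntegral.integral_const_mul, hterm]
    _ = _ := by
        rw [hsum, hsum]
        simp only [Finset.mul_sum, ← Finset.sum_sub_distrib]
        exact Finset.sum_congr rfl fun c _ => Finset.sum_congr rfl fun c' _ => by ring

end HasL2Deriv

theorem Matrix.PosSemidef.quadratic_nonneg {ι : Type*} [Fintype ι] {Q : Matrix ι ι ℝ}
    (hQ : Q.PosSemidef) (x : ι → ℝ) : 0 ≤ x ⬝ᵥ (Q *ᵥ x) := by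
  simpa using hQ.dotProduct_mulVec_nonneg x

theorem Matrix.PosSemidef.transpose_eq {ι : Type*} {Q : Matrix ι ι ℝ}
    (hQ : Q.PosSemidef) : Qᵀ = Q := by
  simpa using hQ.isHermitian.eq

theorem Matrix.dotProduct_mulVec_comm_of_transpose_eq {ι : Type*} [Fintype ι] {Q : Matrix ι ι ℝ}
    (hQ : Qᵀ = Q) (x y : ι → ℝ) : y ⬝ᵥ (Q *ᵥ x) = x ⬝ᵥ (Q *ᵥ y) := by
  rw [dotProduct_mulVec, ← mulVec_transpose, hQ, dotProduct_comm]

/-! ### Wirtinger's inequality and the reciprocally convex Jensen inequality -/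

namespace HasL2Deriv

variable {ι : Type*} [Fintype ι] {e g : ℝ → ι → ℝ}

/-- A Riccati argument: φ(u) = c tan(c(b - u)) solves φ' = -c² - φ². With z = e - e(a), the integral
of the derivative of φ z'Wz vanishes because z(a) = 0 and φ(b) = 0, so adding it to c² z'Wz costs
nothing and leaves 2φ z'Wg - φ² z'Wz. The strict bound on c (b - a) keeps the tangent away from its
pole. -/
theorem wirtinger_of_lt (hp : HasL2Deriv e g) {W : Matrix ι ι ℝ} (hW : W.PosSemidef) {a b c : ℝ}
    (hab : a ≤ b) (hc : 0 ≤ c) (hcb : c * (b - a) < Real.pi / 2) :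
    c ^ 2 * ∫ u in a..b, (e u - e a) ⬝ᵥ (W *ᵥ (e u - e a)) ≤
      ∫ u in a..b, g u ⬝ᵥ (W *ᵥ g u) := by
  have hz := hp.sub_const (e a)
  set z : ℝ → ι → ℝ := fun u => e u - e a with hzdef
  have hcos : ∀ x ∈ Set.uIcc a b, Real.cos (c * (b - x)) ≠ 0 := by
    intro x hx
    rw [Set.uIcc_of_le hab] at hx
    refine (Real.cos_pos_of_mem_Ioo ⟨?_, ?_⟩).ne'
    · have := mul_nonneg hc (sub_nonneg.2 hx.2)
      linarith [Real.pi_pos]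
    · exact (mul_le_mul_of_nonneg_left (by linarith [hx.1]) hc).trans_lt hcb
  have hφ : ∀ x ∈ Set.uIcc a b, HasDerivAt (fun u => c * Real.tan (c * (b - u)))
      (-c ^ 2 - (c * Real.tan (c * (b - x))) ^ 2) x := by
    intro x hx
    have h1 : HasDerivAt (fun u : ℝ => c * (b - u)) (c * -1) x :=
      ((hasDerivAt_id x).const_sub b).const_mul c
    convert! (((Real.hasDerivAt_tan (hcos x hx)).comp x h1).const_mul c) using 1
    have h2 : 1 / Real.cos (c * (b - x)) ^ 2 = 1 + Real.tan (c * (b - x)) ^ 2 := by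
      rw [Real.tan_eq_sin_div_cos]
      have := hcos x hx
      field_simp
      rw [Real.cos_sq_add_sin_sq]
    rw [h2]; ring
  have hφc : ContinuousOn (fun u => c * Real.tan (c * (b - u))) (Set.uIcc a b) :=
    fun x hx => (hφ x hx).continuousAt.continuousWithinAt
  have hφ'c : ContinuousOn (fun u => -c ^ 2 - (c * Real.tan (c * (b - u))) ^ 2) (Set.uIcc a b) :=
    continuousOn_const.sub (hφc.pow 2)
  have hftc := hz.integral_weighted_quadratic hW.transpose_eq hφ hφ'c
  have hza : z a = 0 := by simp [hzdef]
  have hzc : Continuous z := hz.continuous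
  simp only [hza, sub_self, mul_zero, Real.tan_zero, zero_mul, zero_dotProduct] at hftc
  have hqz : Continuous fun u => z u ⬝ᵥ (W *ᵥ z u) := by fun_prop
  have hi1 : IntervalIntegrable (fun u => (-c ^ 2 - (c * Real.tan (c * (b - u))) ^ 2) *
      (z u ⬝ᵥ (W *ᵥ z u)) + c * Real.tan (c * (b - u)) * (2 * (z u ⬝ᵥ (W *ᵥ g u)))) volume a b :=
    (hφ'c.mul hqz.continuousOn).intervalIntegrable.add
      (((hz.intervalIntegrable_bilinear W hzc a b).const_mul 2).continuousOn_mul hφc)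
  have hi2 := hp.intervalIntegrable_quadratic W a b
  have hi3 : IntervalIntegrable (fun u => c ^ 2 * (z u ⬝ᵥ (W *ᵥ z u))) volume a b :=
    (hqz.intervalIntegrable a b).const_mul _
  have key : ∫ u in a..b, ((c ^ 2 * (z u ⬝ᵥ (W *ᵥ z u))) +
      ((-c ^ 2 - (c * Real.tan (c * (b - u))) ^ 2) * (z u ⬝ᵥ (W *ᵥ z u)) +
        c * Real.tan (c * (b - u)) * (2 * (z u ⬝ᵥ (W *ᵥ g u))))) ≤
      ∫ u in a..b, g u ⬝ᵥ (W *ᵥ g u) := by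
    refine intervalIntegral.integral_mono_on hab (hi3.add hi1) hi2 fun u _ => ?_
    -- Completing the square: g'Wg - 2φ z'Wg + φ² z'Wz is the form of W at g - φz.
    have h := hW.quadratic_nonneg (g u - (c * Real.tan (c * (b - u))) • z u)
    simp only [mulVec_sub, mulVec_smul, sub_dotProduct, dotProduct_sub, smul_dotProduct,
      dotProduct_smul, smul_eq_mul,
      Matrix.dotProduct_mulVec_comm_of_transpose_eq hW.transpose_eq (z u) (g u)] at h
    linarith
  rw [intervalIntegral.integral_add hi3 hi1, hftc, add_zero,
    intervalIntegral.integral_const_mul] at key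
  exact key

/-- Wirtinger's inequality for a function that vanishes at the left end. -/
theorem wirtinger (hp : HasL2Deriv e g) {W : Matrix ι ι ℝ} (hW : W.PosSemidef) {a b τ : ℝ}
    (hab : a ≤ b) (hτ : b - a ≤ τ) :
    Real.pi ^ 2 / 4 * ∫ u in a..b, (e u - e a) ⬝ᵥ (W *ᵥ (e u - e a)) ≤
      τ ^ 2 * ∫ u in a..b, g u ⬝ᵥ (W *ᵥ g u) := by
  have hρ : 0 ≤ ∫ u in a..b, g u ⬝ᵥ (W *ᵥ g u) :=
    intervalIntegral.integral_nonneg hab fun u _ => hW.quadratic_nonneg _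
  rcases hab.eq_or_lt with rfl | hlt
  · simp
  have hpos : 0 < b - a := sub_pos.2 hlt
  set Z := ∫ u in a..b, (e u - e a) ⬝ᵥ (W *ᵥ (e u - e a)) with hZ
  set G := ∫ u in a..b, g u ⬝ᵥ (W *ᵥ g u) with hG
  -- At the critical c = π/(2(b - a)) the tangent blows up at the left end, so the sharp constant is
  -- reached as a limit from below.
  have hlim : (Real.pi / 2 / (b - a)) ^ 2 * Z ≤ G := by
    have ht : Filter.Tendsto (fun c : ℝ => c ^ 2 * Z) (nhdsWithin (Real.pi / 2 / (b - a))
        (Set.Iio (Real.pi / 2 / (b - a)))) (nhds ((Real.pi / 2 / (b - a)) ^ 2 * Z)) := by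
      refine Filter.Tendsto.mono_left ?_ nhdsWithin_le_nhds
      exact Continuous.tendsto (by fun_prop) _
    refine le_of_tendsto ht ?_
    have h0 : (0 : ℝ) < Real.pi / 2 / (b - a) := by positivity
    filter_upwards [self_mem_nhdsWithin, mem_nhdsWithin_of_mem_nhds (lt_mem_nhds h0)] with c h1 h2
    exact hp.wirtinger_of_lt hW hab h2.le ((lt_div_iff₀ hpos).1 h1)
  have h2 : Real.pi ^ 2 / 4 * Z ≤ (b - a) ^ 2 * G := by
    have := mul_le_mul_of_nonneg_left hlim (sq_nonneg (b - a))
    have h3 : (b - a) ^ 2 * ((Real.pi / 2 / (b - a)) ^ 2 * Z) = Real.pi ^ 2 / 4 * Z := by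
      field_simp
      ring
    linarith
  exact h2.trans (mul_le_mul_of_nonneg_right (pow_le_pow_left₀ hpos.le hτ 2) hρ)

/-- The pointwise bound for the pair g(u), g(v) is integrated over the rectangle [a, b] × [c, d],
one variable at a time: first with a free vector y, then with y = g(v). No interval length is
divided by, so degenerate intervals need no separate treatment. -/
theorem two_mul_bilinear_le (hp : HasL2Deriv e g) {R M : Matrix ι ι ℝ}
    (hM : ∀ x y : ι → ℝ, 2 * (x ⬝ᵥ (M *ᵥ y)) ≤ x ⬝ᵥ (R *ᵥ x) + y ⬝ᵥ (R *ᵥ y))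
    {a b c d : ℝ} (hab : a ≤ b) (hcd : c ≤ d) :
    2 * ((e b - e a) ⬝ᵥ (M *ᵥ (e d - e c))) ≤
      (d - c) * (∫ u in a..b, g u ⬝ᵥ (R *ᵥ g u)) + (b - a) * ∫ u in c..d, g u ⬝ᵥ (R *ᵥ g u) := by
  have h1 : ∀ y : ι → ℝ, 2 * ((e b - e a) ⬝ᵥ (M *ᵥ y)) ≤
      (∫ u in a..b, g u ⬝ᵥ (R *ᵥ g u)) + (b - a) * (y ⬝ᵥ (R *ᵥ y)) := by
    intro y
    have hi := (hp.intervalIntegrable_dotProduct (M *ᵥ y) a b).const_mul 2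
    have := intervalIntegral.integral_mono_on (μ := volume) hab hi
      ((hp.intervalIntegrable_quadratic R a b).add intervalIntegrable_const)
      (g := fun u => g u ⬝ᵥ (R *ᵥ g u) + y ⬝ᵥ (R *ᵥ y))
      fun u _ => by rw [dotProduct_comm]; exact hM (g u) y
    rw [intervalIntegral.integral_add (hp.intervalIntegrable_quadratic R a b)
      intervalIntegrable_const, intervalIntegral.integral_const_mul, hp.integral_dotProduct,
      intervalIntegral.integral_const, smul_eq_mul, dotProduct_comm] at this
    exact this
  set I := ∫ u in a..b, g u ⬝ᵥ (R *ᵥ g u) with hI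
  have hi := (hp.intervalIntegrable_dotProduct (Mᵀ *ᵥ (e b - e a)) c d).const_mul 2
  have hR := (hp.intervalIntegrable_quadratic R c d).const_mul (b - a)
  have hmv : ∀ y : ι → ℝ, (Mᵀ *ᵥ (e b - e a)) ⬝ᵥ y = (e b - e a) ⬝ᵥ (M *ᵥ y) := by
    intro y
    rw [mulVec_transpose, dotProduct_mulVec]
  have := intervalIntegral.integral_mono_on (μ := volume) hcd hi
    ((intervalIntegrable_const (c := I)).add hR)
    (g := fun u => I + (b - a) * (g u ⬝ᵥ (R *ᵥ g u)))
    fun u _ => by rw [hmv]; exact h1 (g u)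
  rw [intervalIntegral.integral_add intervalIntegrable_const hR,
    intervalIntegral.integral_const_mul, hp.integral_dotProduct, hmv,
    intervalIntegral.integral_const, intervalIntegral.integral_const_mul, smul_eq_mul] at this
  exact this

/-- The combination of Jensen's inequality and the reciprocally convex combination inequality. -/
theorem reciprocally_convex (hp : HasL2Deriv e g) {R M : Matrix ι ι ℝ} (hR : R.PosSemidef)
    (hM : ∀ x y : ι → ℝ, 2 * (x ⬝ᵥ (M *ᵥ y)) ≤ x ⬝ᵥ (R *ᵥ x) + y ⬝ᵥ (R *ᵥ y))
    {s : ℕ → ℝ} {m : ℕ} (hs : ∀ l < m, s (l + 1) ≤ s l) :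
    ∑ k ∈ Finset.range m, ∑ l ∈ Finset.range m,
      (e (s k) - e (s (k + 1))) ⬝ᵥ ((if k = l then R else M) *ᵥ (e (s l) - e (s (l + 1)))) ≤
      (s 0 - s m) * ∫ u in (s m)..(s 0), g u ⬝ᵥ (R *ᵥ g u) := by
  have hRR : ∀ x y : ι → ℝ, 2 * (x ⬝ᵥ (R *ᵥ y)) ≤ x ⬝ᵥ (R *ᵥ x) + y ⬝ᵥ (R *ᵥ y) := by
    intro x y
    have h := hR.quadratic_nonneg (x - y)
    simp only [mulVec_sub, sub_dotProduct, dotProduct_sub,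
      Matrix.dotProduct_mulVec_comm_of_transpose_eq hR.transpose_eq x y] at h
    linarith
  set E : ℕ → ℝ := fun k => ∫ u in (s (k + 1))..(s k), g u ⬝ᵥ (R *ᵥ g u) with hE
  -- The diagonal pairs use R in place of M and give Jensen's inequality. Summed over all pairs, the
  -- right-hand sides factor into total length times total energy.
  have hpair : ∀ k < m, ∀ l < m,
      (e (s k) - e (s (k + 1))) ⬝ᵥ ((if k = l then R else M) *ᵥ (e (s l) - e (s (l + 1)))) ≤
      ((s l - s (l + 1)) * E k + (s k - s (k + 1)) * E l) / 2 := by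
    intro k hk l hl
    rw [le_div_iff₀ two_pos, mul_comm]
    refine hp.two_mul_bilinear_le ?_ (hs k hk) (hs l hl)
    split_ifs
    exacts [hRR, hM]
  have hlen : ∑ k ∈ Finset.range m, (s k - s (k + 1)) = s 0 - s m := Finset.sum_range_sub' s m
  have hEsum : ∑ k ∈ Finset.range m, E k = ∫ u in (s m)..(s 0), g u ⬝ᵥ (R *ᵥ g u) := by
    have hi : ∀ a b, IntervalIntegrable (fun u => g u ⬝ᵥ (R *ᵥ g u)) volume a b :=
      hp.intervalIntegrable_quadratic R
    have h1 : ∀ k, E k = (∫ u in (0 : ℝ)..(s k), g u ⬝ᵥ (R *ᵥ g u)) -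
        ∫ u in (0 : ℝ)..(s (k + 1)), g u ⬝ᵥ (R *ᵥ g u) := fun k =>
      (intervalIntegral.integral_interval_sub_left (hi _ _) (hi _ _)).symm
    simp only [h1]
    rw [Finset.sum_range_sub' (fun k => ∫ u in (0 : ℝ)..(s k), g u ⬝ᵥ (R *ᵥ g u)),
      intervalIntegral.integral_interval_sub_left (hi _ _) (hi _ _)]
  calc _ ≤ ∑ k ∈ Finset.range m, ∑ l ∈ Finset.range m,
        ((s l - s (l + 1)) * E k + (s k - s (k + 1)) * E l) / 2 :=
        Finset.sum_le_sum fun k hk => Finset.sum_le_sum fun l hl =>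
          hpair k (Finset.mem_range.1 hk) l (Finset.mem_range.1 hl)
    _ = (s 0 - s m) * ∫ u in (s m)..(s 0), g u ⬝ᵥ (R *ᵥ g u) := by
        simp only [← Finset.sum_div, Finset.sum_add_distrib, ← Finset.sum_mul, ← Finset.mul_sum,
          hlen, hEsum]
        ring

end HasL2Deriv

/-! ### Delayed terms with exponential weights -/

/-- After the shift only the end pieces survive: the integral over [T - τ, T], at most τ F(T) by
monotonicity, and the one over [a - τ, a], which vanishes. -/
theorem integral_sub_shift_le {F : ℝ → ℝ} (hF : Monotone F) (hc : Continuous F) {a T τ : ℝ}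
    (h0 : ∀ u ≤ a, F u = 0) (hτ : 0 ≤ τ) :
    ∫ u in a..T, (F u - F (u - τ)) ≤ τ * F T := by
  have hi : ∀ x y, IntervalIntegrable F volume x y := hc.intervalIntegrable
  have hs : Continuous fun u => F (u - τ) := hc.comp (continuous_sub_right τ)
  rw [intervalIntegral.integral_sub (hi _ _) (hs.intervalIntegrable _ _),
    intervalIntegral.integral_comp_sub_right (fun u => F u),
    intervalIntegral.integral_interval_sub_interval_comm (hi _ _) (hi _ _) (hi _ _)]
  have h1 : ∫ u in a..(a - τ), F u = 0 := by
    rw [intervalIntegral.integral_symm, intervalIntegral.integral_congr (g := fun _ => 0)]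
    · simp
    · intro u hu
      rw [Set.uIcc_of_le (by linarith)] at hu
      exact h0 u hu.2
  have h2 : ∫ u in (T - τ)..T, F u ≤ ∫ _ in (T - τ)..T, F T :=
    intervalIntegral.integral_mono_on (by linarith) (hi _ _) intervalIntegrable_const
      fun u hu => hF hu.2
  rw [intervalIntegral.integral_const, smul_eq_mul, sub_sub_cancel] at h2
  rw [h1, intervalIntegral.integral_symm (T - τ)]
  linarith

theorem continuous_integral_delay {ρ : ℝ → ℝ} (hi : ∀ x y, IntervalIntegrable ρ volume x y)
    (τ : ℝ) : Continuous fun u => ∫ s in (u - τ)..u, ρ s := by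
  have h1 : (fun u => ∫ s in (u - τ)..u, ρ s) =
      fun u => (∫ s in (0 : ℝ)..u, ρ s) - ∫ s in (0 : ℝ)..(u - τ), ρ s := by
    funext u
    exact (intervalIntegral.integral_interval_sub_left (hi _ _) (hi _ _)).symm
  rw [h1]
  have := intervalIntegral.continuous_primitive hi 0
  exact this.sub (this.comp (continuous_sub_right τ))

/-- For s ≥ u - τ the outer weight satisfies e^{2βu} ≤ e^{2βτ} e^{2βs}. Moving it inside turns the
inner integral into a difference F(u) - F(u - τ) of a monotone primitive, which replaces an exchange
of integrals. -/
theorem integral_weighted_delay_le {ρ : ℝ → ℝ} (hρ : ∀ u, 0 ≤ ρ u) {a T τ β : ℝ}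
    (hi : ∀ x y, IntervalIntegrable ρ volume x y) (h0 : ∀ u ≤ a, ρ u = 0) (haT : a ≤ T)
    (hτ : 0 ≤ τ) (hβ : 0 ≤ β) :
    ∫ u in a..T, Real.exp (2 * β * u) * ∫ s in (u - τ)..u, ρ s ≤
      Real.exp (2 * β * τ) * (τ * ∫ u in a..T, Real.exp (2 * β * u) * ρ u) := by
  have hw : Continuous fun u : ℝ => Real.exp (2 * β * u) := by fun_prop
  have hiw : ∀ x y, IntervalIntegrable (fun u => Real.exp (2 * β * u) * ρ u) volume x y :=
    fun x y => (hi x y).continuousOn_mul hw.continuousOn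
  set F : ℝ → ℝ := fun t => ∫ u in a..t, Real.exp (2 * β * u) * ρ u with hFdef
  have hFc : Continuous F := intervalIntegral.continuous_primitive hiw a
  have hsub : ∀ x y, F y - F x = ∫ u in x..y, Real.exp (2 * β * u) * ρ u := fun x y =>
    intervalIntegral.integral_interval_sub_left (hiw _ _) (hiw _ _)
  have hFm : Monotone F := fun x y hxy => by
    rw [← sub_nonneg, hsub]
    exact intervalIntegral.integral_nonneg hxy fun u _ => mul_nonneg (Real.exp_pos _).le (hρ u)
  have hF0 : ∀ u ≤ a, F u = 0 := fun u hu => by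
    rw [hFdef]
    simp only
    rw [intervalIntegral.integral_congr (g := fun _ => 0)]
    · simp
    · intro s hs
      rw [Set.uIcc_of_ge hu] at hs
      simp [h0 s hs.2]
  have hcP := continuous_integral_delay hi τ
  have hle : ∫ u in a..T, Real.exp (2 * β * u) * ∫ s in (u - τ)..u, ρ s ≤
      ∫ u in a..T, Real.exp (2 * β * τ) * (F u - F (u - τ)) := by
    refine intervalIntegral.integral_mono_on haT ((hw.mul hcP).intervalIntegrable _ _)
      ((continuous_const.mul (hFc.sub (hFc.comp (continuous_sub_right τ)))).intervalIntegrable _ _)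
      fun u _ => ?_
    rw [hsub, ← intervalIntegral.integral_const_mul, ← intervalIntegral.integral_const_mul]
    refine intervalIntegral.integral_mono_on (by linarith) ((hi _ _).const_mul _)
      ((hiw _ _).const_mul _) fun s hs => ?_
    rw [← mul_assoc, ← Real.exp_add]
    refine mul_le_mul_of_nonneg_right (Real.exp_le_exp.2 ?_) (hρ s)
    nlinarith [hs.1]
  refine hle.trans ?_
  rw [intervalIntegral.integral_const_mul]
  exact mul_le_mul_of_nonneg_left (integral_sub_shift_le hFm hFc hF0 hτ) (Real.exp_pos _).le

/-- The weight e^{2βu} turns the factor e^{-2ατ} of the delayed term into κ = e^{-2(α-β)τ} ≤ 1 times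
a shift of w(u) = e^{2βu} σ(u). After the shift of variable, the part of the delayed integral after
a is dominated by the undelayed one. Only the constant history on [a - τ, a] has to be paid for. -/
theorem integral_weighted_sub_delay_ge {σ : ℝ → ℝ} (hσ : ∀ u, 0 ≤ σ u) (hc : Continuous σ)
    {a T τ α β σ₀ : ℝ} (h0 : ∀ u ≤ a, σ u = σ₀) (haT : a ≤ T) (hτ : 0 ≤ τ) (hβ : 0 ≤ β)
    (hβα : β ≤ α) :
    -(Real.exp (-2 * (α - β) * τ) * (τ * (Real.exp (2 * β * a) * σ₀))) ≤
      ∫ u in a..T, Real.exp (2 * β * u) * (σ u - Real.exp (-2 * α * τ) * σ (u - τ)) := by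
  set w : ℝ → ℝ := fun u => Real.exp (2 * β * u) * σ u with hwdef
  have hw : Continuous w := by fun_prop
  have hw0 : ∀ u, 0 ≤ w u := fun u => mul_nonneg (Real.exp_pos _).le (hσ u)
  have hi : ∀ x y, IntervalIntegrable w volume x y := hw.intervalIntegrable
  have hσ₀ : 0 ≤ σ₀ := h0 a le_rfl ▸ hσ a
  set κ := Real.exp (-2 * (α - β) * τ) with hκ
  have hκ0 : 0 ≤ κ := (Real.exp_pos _).le
  have hκ1 : κ ≤ 1 := Real.exp_le_one_iff.2 (by nlinarith [mul_nonneg (sub_nonneg.2 hβα) hτ])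
  have h1 : ∫ u in a..T, Real.exp (2 * β * u) * (σ u - Real.exp (-2 * α * τ) * σ (u - τ)) =
      (∫ u in a..T, w u) - κ * ∫ u in (a - τ)..(T - τ), w u := by
    have hs : Continuous fun u => κ * w (u - τ) :=
      continuous_const.mul (hw.comp (continuous_sub_right τ))
    rw [← intervalIntegral.integral_comp_sub_right (fun u => w u),
      ← intervalIntegral.integral_const_mul, ← intervalIntegral.integral_sub (hi _ _)
      (hs.intervalIntegrable _ _)]
    refine intervalIntegral.integral_congr fun u _ => ?_
    simp only [hwdef, hκ]
    rw [← mul_assoc (Real.exp (-2 * (α - β) * τ)), ← Real.exp_add, mul_sub, ← mul_assoc,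
      ← Real.exp_add]
    congr 3
    ring
  have h2 : ∫ u in (a - τ)..(T - τ), w u ≤ ∫ u in (a - τ)..T, w u := by
    rw [← intervalIntegral.integral_add_adjacent_intervals (hi (a - τ) (T - τ)) (hi _ T)]
    linarith [intervalIntegral.integral_nonneg (a := T - τ) (b := T) (μ := volume) (by linarith)
      fun u _ => hw0 u]
  have h3 : ∫ u in (a - τ)..T, w u = (∫ u in (a - τ)..a, w u) + ∫ u in a..T, w u :=
    (intervalIntegral.integral_add_adjacent_intervals (hi _ _) (hi _ _)).symm
  have h4 : ∫ u in (a - τ)..a, w u ≤ τ * (Real.exp (2 * β * a) * σ₀) := by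
    have := intervalIntegral.integral_mono_on (a := a - τ) (b := a) (by linarith) (hi _ _)
      (intervalIntegrable_const (μ := volume) (c := Real.exp (2 * β * a) * σ₀))
      fun u hu => by
        rw [hwdef]
        simp only
        rw [h0 u hu.2]
        exact mul_le_mul_of_nonneg_right (Real.exp_le_exp.2 (by nlinarith [hu.2])) hσ₀
    rwa [intervalIntegral.integral_const, smul_eq_mul, sub_sub_cancel] at this
  have h5 : 0 ≤ ∫ u in a..T, w u := intervalIntegral.integral_nonneg haT fun u _ => hw0 u
  rw [h1]
  nlinarith [mul_le_mul_of_nonneg_left (h2.trans_eq h3) hκ0, mul_le_mul_of_nonneg_left h4 hκ0,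
    mul_nonneg (sub_nonneg.2 hκ1) h5]

/-! ### The Round-Robin schedule -/

namespace RRNetwork

theorem shift_perm {α : Type*} (l : List α) : (shift l).Perm l := List.rotate_perm _ _

theorem idxOf_shift {α : Type*} [DecidableEq α] {l : List α} {j : α} (hj : j ∈ l) :
    (shift l).idxOf j = l.idxOf j + 1 ∨ (shift l).idxOf j = 0 := by
  rcases List.eq_nil_or_concat' l with rfl | ⟨L, b, rfl⟩
  · simp at hj
  have hs : shift (L ++ [b]) = b :: L := by
    simp [shift, List.rotate_append_length_eq]
  rw [hs]
  by_cases hb : b = j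
  · right
    simp [hb]
  · left
    have hL : j ∈ L := by
      rcases List.mem_append.1 hj with h | h
      · exact h
      · exact absurd (List.mem_singleton.1 h).symm hb
    rw [List.idxOf_cons_ne _ hb, List.idxOf_append_of_mem hL]

variable {N n mw mv : ℕ} {r h : Fin N → ℕ} (net : RRNetwork N n mw mv r h)

theorem polling_succ (i : Fin N) (k : ℕ) : net.polling i (k + 1) = shift (net.polling i k) :=
  Function.iterate_succ_apply' _ _ _

theorem polling_perm (i : Fin N) (k : ℕ) :
    (net.polling i k).Perm ((net.nbr i).sort (· ≤ ·)) := by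
  induction k with
  | zero => exact List.Perm.refl _
  | succ k ih => rw [polling_succ]; exact (shift_perm _).trans ih

theorem mem_polling {i j : Fin N} {k : ℕ} : j ∈ net.polling i k ↔ j ∈ net.nbr i := by
  rw [(net.polling_perm i k).mem_iff, Finset.mem_sort]

theorem length_polling (i : Fin N) (k : ℕ) : (net.polling i k).length = net.p i := by
  rw [(net.polling_perm i k).length_eq, Finset.length_sort, p]

theorem nodup_polling (i : Fin N) (k : ℕ) : (net.polling i k).Nodup :=
  (net.polling_perm i k).nodup_iff.2 (Finset.sort_nodup _ _)

theorem sampleTime_eq (i j : Fin N) (k : ℕ) :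
    net.sampleTime i k j = net.t (k - (net.polling i k).idxOf j) := by
  rw [sampleTime, ν, Nat.add_sub_add_right]

/-- Rotation moves a neighbour one place back while k grows by one, so the index of its sample is
unchanged, also under truncated subtraction. The neighbour that wraps around to the front is sampled
afresh. -/
theorem sampleTime_succ {i j : Fin N} (hj : j ∈ net.nbr i) (k : ℕ) :
    net.sampleTime i (k + 1) j = net.sampleTime i k j ∨
      net.sampleTime i (k + 1) j = net.t (k + 1) := by
  rw [sampleTime_eq, sampleTime_eq, polling_succ]
  rcases idxOf_shift (net.mem_polling (k := k) |>.2 hj) with h | h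
  · left; rw [h, Nat.add_sub_add_right]
  · right; rw [h, Nat.sub_zero]

/-- The polling list is a permutation of the neighbourhood, so the positions run once through 0, …,
p - 1. Hence node i's own samples enter the error equation through a fixed sum over the last p
instants, independent of the polling order. -/
theorem sum_sampleTime (i : Fin N) (k : ℕ) {M : Type*} [AddCommMonoid M] (f : ℝ → M) :
    ∑ j ∈ net.nbr i, f (net.sampleTime i k j) =
      ∑ l ∈ Finset.range (net.p i), f (net.t (k - l)) := by
  refine Finset.sum_nbij (fun j => (net.polling i k).idxOf j) ?_ ?_ ?_ ?_
  · intro j hj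
    rw [Finset.mem_range, ← net.length_polling i k]
    exact List.idxOf_lt_length_of_mem (net.mem_polling.2 hj)
  · intro j hj j' _ hjj
    exact (List.idxOf_inj (net.mem_polling.2 hj)).1 hjj
  · intro l hl
    have hl' : l < (net.polling i k).length := by
      rw [length_polling]; exact Finset.mem_range.1 hl
    exact ⟨(net.polling i k)[l], net.mem_polling.1 (List.getElem_mem hl'),
      (net.nodup_polling i k).idxOf_getElem l hl'⟩
  · intro j _
    simp only [sampleTime_eq]

theorem sampleTime_le (i j : Fin N) (k : ℕ) : net.sampleTime i k j ≤ net.t k := by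
  rw [sampleTime_eq]
  exact net.t_strictMono.monotone (Nat.sub_le _ _)

theorem t_nonneg (k : ℕ) : 0 ≤ net.t k :=
  net.t_zero ▸ net.t_strictMono.monotone (Nat.zero_le k)

theorem pollGap_nonneg (i : Fin N) (k : ℕ) : 0 ≤ net.pollGap i k :=
  sub_nonneg.2 (net.t_strictMono.monotone (Nat.sub_le _ _))

theorem τ_nonneg (i : Fin N) : 0 ≤ net.τ i := Real.iSup_nonneg (net.pollGap_nonneg i)

theorem sub_le_τ {i : Fin N} (hτ : BddAbove (Set.range (net.pollGap i))) (k : ℕ) :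
    net.t (k + 1) - net.t (k + 1 - net.p i) ≤ net.τ i :=
  le_ciSup hτ k

/-- Measured up to the end of the interval, so the delay bound holds on all of [t_k, t_{k+1}]. The
zero-based position is at most p - 1, which gives k - position ≥ k + 1 - p. -/
theorem sub_sampleTime_le {i j : Fin N} (hτ : BddAbove (Set.range (net.pollGap i)))
    (hj : j ∈ net.nbr i) (k : ℕ) : net.t (k + 1) - net.sampleTime i k j ≤ net.τ i := by
  refine le_trans ?_ (net.sub_le_τ hτ k)
  rw [sampleTime_eq]
  have h1 := List.idxOf_lt_length_of_mem (net.mem_polling (k := k) |>.2 hj)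
  rw [length_polling] at h1
  exact sub_le_sub_left (net.t_strictMono.monotone (by omega)) _

/-! ### The index of the current sampling interval -/

theorem exists_lt_t_succ (u : ℝ) : ∃ k, u < net.t (k + 1) := by
  obtain ⟨k, hk⟩ := (net.t_tendsto.eventually_gt_atTop u).exists
  exact ⟨k, hk.trans (net.t_strictMono k.lt_succ_self)⟩

open Classical in
/-- The index `k` with `u ∈ [t_k, t_{k+1})`. -/
noncomputable def idx (u : ℝ) : ℕ := Nat.find (net.exists_lt_t_succ u)

theorem lt_t_idx_succ (u : ℝ) : u < net.t (net.idx u + 1) := by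
  classical exact Nat.find_spec (net.exists_lt_t_succ u)

theorem t_idx_le {u : ℝ} (hu : 0 ≤ u) : net.t (net.idx u) ≤ u := by
  classical
  rcases hk : net.idx u with _ | k
  · rwa [net.t_zero]
  · have : k < Nat.find (net.exists_lt_t_succ u) := by
      change k < net.idx u
      omega
    exact not_lt.1 (Nat.find_min _ this)

theorem le_idx {m : ℕ} {u : ℝ} (hu : net.t m ≤ u) : m ≤ net.idx u := by
  have := net.t_strictMono.lt_iff_lt.1 (hu.trans_lt (net.lt_t_idx_succ u))
  omega

theorem idx_eq {k : ℕ} {u : ℝ} (h1 : net.t k ≤ u) (h2 : u < net.t (k + 1)) : net.idx u = k := by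
  refine le_antisymm ?_ (net.le_idx h1)
  have := net.t_strictMono.lt_iff_lt.1 ((net.t_idx_le ((net.t_nonneg k).trans h1)).trans_lt h2)
  omega

theorem idx_mono : Monotone net.idx := by
  intro u v huv
  classical exact Nat.find_mono fun k hk => huv.trans_lt hk

theorem measurable_idx : Measurable net.idx := net.idx_mono.measurable

end RRNetwork

/-! ### Held signals and regularity of the estimation errors -/

theorem memLp_two_of_bound {f : ℝ → ℝ} (hf : Measurable f) {a b C : ℝ}
    (hC : ∀ u ∈ Set.Ioc a b, |f u| ≤ C) : MemLp f 2 (volume.restrict (Set.Ioc a b)) :=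
  MemLp.of_bound hf.aestronglyMeasurable C
    ((ae_restrict_iff' measurableSet_Ioc).2 (Filter.Eventually.of_forall hC))

theorem Continuous.memLp_two_Ioc {f : ℝ → ℝ} (hf : Continuous f) (a b : ℝ) :
    MemLp f 2 (volume.restrict (Set.Ioc a b)) := by
  obtain ⟨C, hC⟩ := (isCompact_Icc (a := a) (b := b)).exists_bound_of_continuousOn hf.continuousOn
  exact memLp_two_of_bound hf.measurable fun u hu => hC u (Set.Ioc_subset_Icc_self hu)

theorem memLp_mulVec {ι κ : Type*} [Fintype κ] (M : Matrix ι κ ℝ) {f : ℝ → κ → ℝ}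
    {μ : Measure ℝ} (hf : ∀ d, MemLp (fun u => f u d) 2 μ) (c : ι) :
    MemLp (fun u => (M *ᵥ f u) c) 2 μ := by
  simp only [mulVec, dotProduct]
  exact memLp_finsetSum _ fun d _ => (hf d).const_mul (M c d)

namespace RRNetwork

variable {N n mw mv : ℕ} {r h : Fin N → ℕ} (net : RRNetwork N n mw mv r h)

/-- The value of the signal `f` that is held on the channel `(j, i)` at time `u`. -/
noncomputable def held (f : ℝ → Fin n → ℝ) (i j : Fin N) (u : ℝ) : Fin n → ℝ :=
  f (net.sampleTime i (net.idx u) j)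

theorem measurable_held (f : ℝ → Fin n → ℝ) (i j : Fin N) (c : Fin n) :
    Measurable fun u => net.held f i j u c :=
  (measurable_from_nat (f := fun k => f (net.sampleTime i k j) c)).comp net.measurable_idx

/-- Up to time b only the finitely many samples with k ≤ `idx b` occur, and the sum of their
absolute values is a bound. -/
theorem memLp_held (f : ℝ → Fin n → ℝ) (i j : Fin N) (c : Fin n) (a b : ℝ) :
    MemLp (fun u => net.held f i j u c) 2 (volume.restrict (Set.Ioc a b)) := by
  refine memLp_two_of_bound (net.measurable_held f i j c)
    (C := ∑ k ∈ Finset.range (net.idx b + 1), |f (net.sampleTime i k j) c|) fun u hu => ?_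
  refine Finset.single_le_sum (f := fun k => |f (net.sampleTime i k j) c|)
    (fun _ _ => abs_nonneg _) (Finset.mem_range.2 ?_)
  exact Nat.lt_succ_of_le (net.idx_mono hu.2)

/-- The right-hand side of the error equation of node `i`, and zero before the initial time. -/
noncomputable def errorRate (K : ∀ i, Matrix (Fin n) (Fin (h i)) ℝ)
    (L : ∀ i, Matrix (Fin n) (Fin (r i)) ℝ) (ξ : Fin N → ℝ → (Fin mw ⊕ Fin mv) → ℝ) (m : ℕ)
    (e : Fin N → ℝ → Fin n → ℝ) (i : Fin N) : ℝ → Fin n → ℝ :=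
  (Set.Ioi (net.t m)).indicator fun u =>
    (net.A - L i * net.C i) *ᵥ e i u + (net.B - L i * net.D i) *ᵥ ξ i u +
      (K i * net.H i) *ᵥ ∑ j ∈ net.nbr i, (net.held (e j) i j u - net.held (e i) i j u)

variable {net} {K : ∀ i, Matrix (Fin n) (Fin (h i)) ℝ} {L : ∀ i, Matrix (Fin n) (Fin (r i)) ℝ}
  {ξ : Fin N → ℝ → (Fin mw ⊕ Fin mv) → ℝ} {m : ℕ} {φ : Fin N → Fin n → ℝ}
  {e : Fin N → ℝ → Fin n → ℝ}

theorem memLp_errorRate (he : ∀ i, Continuous (e i))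
    (hξ : ∀ i c, MemLp (fun u => ξ i u c) 2 (volume.restrict (Set.Ioi (net.t m))))
    (i : Fin N) (c : Fin n) (a b : ℝ) :
    MemLp (fun u => net.errorRate K L ξ m e i u c) 2 (volume.restrict (Set.Ioc a b)) := by
  -- The disturbance is square integrable only after t_m. Expressing the rate as an indicator moves
  -- the restriction onto the measure, where both this and local boundedness on (a, b] are
  -- available.
  have hind : (fun u => net.errorRate K L ξ m e i u c) = (Set.Ioi (net.t m)).indicator fun u =>
      ((net.A - L i * net.C i) *ᵥ e i u) c + ((net.B - L i * net.D i) *ᵥ ξ i u) c +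
      ((K i * net.H i) *ᵥ ∑ j ∈ net.nbr i, (net.held (e j) i j u - net.held (e i) i j u)) c := by
    funext u
    by_cases hu : u ∈ Set.Ioi (net.t m) <;> simp [errorRate, hu]
  rw [hind, memLp_indicator_iff_restrict measurableSet_Ioi,
    Measure.restrict_restrict measurableSet_Ioi]
  have hmono : volume.restrict (Set.Ioi (net.t m) ∩ Set.Ioc a b) ≤
      volume.restrict (Set.Ioc a b) := Measure.restrict_mono Set.inter_subset_right le_rfl
  have hmono' : volume.restrict (Set.Ioi (net.t m) ∩ Set.Ioc a b) ≤
      volume.restrict (Set.Ioi (net.t m)) := Measure.restrict_mono Set.inter_subset_left le_rfl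
  refine MemLp.add (MemLp.add ?_ ?_) ?_
  · exact memLp_mulVec _ (fun d =>
      (((continuous_apply d).comp (he i)).memLp_two_Ioc a b).mono_measure hmono) c
  · exact memLp_mulVec _ (fun d => (hξ i d).mono_measure hmono') c
  · refine memLp_mulVec _ (fun d => ?_) c
    simp only [Finset.sum_apply, Pi.sub_apply]
    exact memLp_finsetSum _ fun j _ => ((net.memLp_held (e j) i j d a b).mono_measure hmono).sub
      ((net.memLp_held (e i) i j d a b).mono_measure hmono)

theorem errorRate_of_le {u : ℝ} (hu : u ≤ net.t m) (i : Fin N) :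
    net.errorRate K L ξ m e i u = 0 :=
  Set.indicator_of_notMem (by simpa using hu) _

theorem errorRate_of_lt {u : ℝ} (hu : net.t m < u) (i : Fin N) :
    net.errorRate K L ξ m e i u =
      (net.A - L i * net.C i) *ᵥ e i u + (net.B - L i * net.D i) *ᵥ ξ i u +
      (K i * net.H i) *ᵥ ∑ j ∈ net.nbr i, (net.held (e j) i j u - net.held (e i) i j u) :=
  Set.indicator_of_mem (Set.mem_Ioi.2 hu) _

/-- The estimation errors are absolutely continuous. -/
theorem IsErrorTrajectory.hasL2Deriv (he : net.IsErrorTrajectory K L ξ m φ e)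
    (hξ : ∀ i c, MemLp (fun u => ξ i u c) 2 (volume.restrict (Set.Ioi (net.t m)))) (i : Fin N) :
    HasL2Deriv (e i) (net.errorRate K L ξ m e i) := by
  obtain ⟨hc, hinit, heq⟩ := he
  have hL := memLp_errorRate (K := K) (L := L) hc hξ i
  have hint : ∀ c a b, IntervalIntegrable (fun u => net.errorRate K L ξ m e i u c) volume a b :=
    fun c a b => ⟨(hL c a b).integrable (by norm_num), (hL c b a).integrable (by norm_num)⟩
  have hpiece : ∀ k ≥ m, ∀ s ∈ Set.Icc (net.t k) (net.t (k + 1)), ∀ c,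
      e i s c = e i (net.t k) c + ∫ u in (net.t k)..s, net.errorRate K L ξ m e i u c := by
    intro k hk s hs c
    have h1 : (∫ u in (net.t k)..s, ((net.A - L i * net.C i) *ᵥ e i u +
        (net.B - L i * net.D i) *ᵥ ξ i u + (K i * net.H i) *ᵥ ∑ j ∈ net.nbr i,
            (e j (net.sampleTime i k j) - e i (net.sampleTime i k j)))) =
        ∫ u in (net.t k)..s, net.errorRate K L ξ m e i u := by
      -- Passing to the open interval discards the right end, where `idx` may already equal k + 1.
      rw [intervalIntegral.integral_of_le hs.1, intervalIntegral.integral_of_le hs.1,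
        integral_Ioc_eq_integral_Ioo, integral_Ioc_eq_integral_Ioo]
      refine setIntegral_congr_fun measurableSet_Ioo fun u hu => ?_
      have h2 : net.t m < u := (net.t_strictMono.monotone hk).trans_lt hu.1
      have h3 : net.idx u = k := net.idx_eq hu.1.le (hu.2.trans_le hs.2)
      simp only [errorRate_of_lt h2, held, h3]
    rw [heq i k hk s hs, h1, Pi.add_apply, intervalIntegral.integral_of_le hs.1,
      intervalIntegral.integral_of_le hs.1, eval_integral fun c' => (hint c' _ _).1]
  have hmain : ∀ c s, e i s c = φ i c + ∫ u in (net.t m)..s, net.errorRate K L ξ m e i u c := by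
    intro c s
    have hnode : ∀ k ≥ m, e i (net.t k) c =
        φ i c + ∫ u in (net.t m)..(net.t k), net.errorRate K L ξ m e i u c := by
      intro k hk
      induction k, hk using Nat.le_induction with
      | base => simp [hinit i (net.t m) le_rfl]
      | succ k hk ih =>
        rw [hpiece k hk _ (Set.right_mem_Icc.2 (net.t_strictMono k.lt_succ_self).le) c, ih,
          add_assoc, intervalIntegral.integral_add_adjacent_intervals (hint _ _ _) (hint _ _ _)]
    rcases le_total s (net.t m) with hs | hs
    · rw [hinit i s hs, intervalIntegral.integral_congr (g := fun _ => 0)]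
      · simp
      · intro u hu
        rw [Set.uIcc_of_ge hs] at hu
        simp [errorRate_of_le hu.2]
    · have h1 := net.t_idx_le ((net.t_nonneg m).trans hs)
      rw [hpiece _ (net.le_idx hs) s ⟨h1, (net.lt_t_idx_succ s).le⟩ c, hnode _ (net.le_idx hs),
        add_assoc, intervalIntegral.integral_add_adjacent_intervals (hint _ _ _) (hint _ _ _)]
  refine ⟨hL, fun a b c => ?_⟩
  rw [hmain c a, hmain c b, add_sub_add_left_eq_sub,
    intervalIntegral.integral_interval_sub_left (hint _ _ _) (hint _ _ _)]

end RRNetwork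

/-! ### Quadratic forms of the block matrices -/

namespace RRBlock

variable {ι κ α β : Type*}

theorem sym_quadratic [Fintype α] [Fintype β] (M₁₁ : Matrix α α ℝ) (M₁₂ : Matrix α β ℝ)
    (M₂₂ : Matrix β β ℝ) (x : α → ℝ) (y : β → ℝ) :
    Sum.elim x y ⬝ᵥ (sym M₁₁ M₁₂ M₂₂ *ᵥ Sum.elim x y) =
      x ⬝ᵥ (M₁₁ *ᵥ x) + 2 * (x ⬝ᵥ (M₁₂ *ᵥ y)) + y ⬝ᵥ (M₂₂ *ᵥ y) := by
  have h : sym M₁₁ M₁₂ M₂₂ *ᵥ Sum.elim x y =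
      Sum.elim (M₁₁ *ᵥ x + M₁₂ *ᵥ y) (M₁₂ᵀ *ᵥ x + M₂₂ *ᵥ y) := by
    rw [sym, fromBlocks_mulVec]
    rfl
  rw [h, sumElim_dotProduct_sumElim, dotProduct_add, dotProduct_add, dotProduct_transpose_mulVec]
  ring

theorem fromCols_mulVec_elim [Fintype α] [Fintype β] (M₁ : Matrix κ α ℝ) (M₂ : Matrix κ β ℝ)
    (x : α → ℝ) (y : β → ℝ) :
    fromCols M₁ M₂ *ᵥ Sum.elim x y = M₁ *ᵥ x + M₂ *ᵥ y := by
  rw [fromCols_mulVec]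
  rfl

theorem oneRow_mulVec [Fintype ι] [Fintype β] (M : Matrix α β ℝ) (x : ι → β → ℝ) :
    oneRow ι M *ᵥ Function.uncurry x = M *ᵥ ∑ l, x l := by
  ext a
  simp only [oneRow, mulVec, dotProduct, of_apply, Fintype.sum_prod_type, Function.uncurry,
    Finset.sum_apply, Finset.mul_sum]
  exact Finset.sum_comm

variable [Fintype ι] [Fintype α]

theorem dotProduct_oneFull_mulVec [Fintype κ] [Fintype β] (M : Matrix α β ℝ) (x : ι → α → ℝ)
    (y : κ → β → ℝ) :
    Function.uncurry x ⬝ᵥ (oneFull ι κ M *ᵥ Function.uncurry y) =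
      (∑ l, x l) ⬝ᵥ (M *ᵥ ∑ j, y j) := by
  have h : oneFull ι κ M *ᵥ Function.uncurry y = fun a => (M *ᵥ ∑ j, y j) a.2 := by
    funext a
    exact congrFun (oneRow_mulVec M y) a.2
  rw [h]
  simp only [dotProduct, Fintype.sum_prod_type, Function.uncurry, Finset.sum_apply, Finset.sum_mul]
  exact Finset.sum_comm

theorem dotProduct_oneCol_mulVec [Fintype β] (M : Matrix α β ℝ) (x : ι → α → ℝ) (y : β → ℝ) :
    Function.uncurry x ⬝ᵥ (oneCol ι M *ᵥ y) = (∑ l, x l) ⬝ᵥ (M *ᵥ y) := by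
  have h : oneCol ι M *ᵥ y = fun a => (M *ᵥ y) a.2 := rfl
  rw [h]
  simp only [dotProduct, Fintype.sum_prod_type, Function.uncurry, Finset.sum_apply, Finset.sum_mul]
  exact Finset.sum_comm

theorem dotProduct_blkDiag_mulVec [DecidableEq ι] (M : ι → Matrix α α ℝ) (x y : ι → α → ℝ) :
    Function.uncurry x ⬝ᵥ (blkDiag M *ᵥ Function.uncurry y) = ∑ j, x j ⬝ᵥ (M j *ᵥ y j) := by
  have h : blkDiag M *ᵥ Function.uncurry y = Function.uncurry fun j => M j *ᵥ y j := by
    funext a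
    simp [blkDiag, mulVec, dotProduct, Fintype.sum_prod_type, Function.uncurry, ite_mul,
      Finset.sum_ite_irrel]
  rw [h]
  simp [dotProduct, Fintype.sum_prod_type, Function.uncurry]

variable {n : ℕ}

theorem dotProduct_Psi_mulVec (p : ℕ) (R G : Matrix (Fin n) (Fin n) ℝ)
    (x : Fin (p + 1) → Fin n → ℝ) :
    Function.uncurry x ⬝ᵥ (Psi p R G *ᵥ Function.uncurry x) =
      ∑ k, ∑ l, x k ⬝ᵥ ((if k = l then R else (1 / 2 : ℝ) • (G + Gᵀ)) *ᵥ x l) := by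
  have h : Psi p R G *ᵥ Function.uncurry x = Function.uncurry fun k => ∑ l,
      (if k = l then R else (1 / 2 : ℝ) • (G + Gᵀ)) *ᵥ x l := by
    funext a
    simp only [Psi, mulVec, dotProduct, Fintype.sum_prod_type, Function.uncurry, of_apply,
      Finset.sum_apply]
    refine Finset.sum_congr rfl fun l _ => Finset.sum_congr rfl fun c _ => ?_
    split_ifs <;> rfl
  rw [h]
  simp only [dotProduct, Fintype.sum_prod_type, Function.uncurry, Finset.sum_apply, Finset.mul_sum]
  exact Finset.sum_congr rfl fun k _ => Finset.sum_comm

theorem T_mulVec (p : ℕ) (x : Fin (p + 2) → Fin n → ℝ) :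
    T n p *ᵥ Function.uncurry x = Function.uncurry fun k => x k.castSucc - x k.succ := by
  funext a
  simp [T, mulVec, dotProduct, Fintype.sum_prod_type, Function.uncurry, sub_mul,
    Finset.sum_sub_distrib, one_apply, ite_mul]

theorem dotProduct_PsiBar_mulVec (p : ℕ) (R G : Matrix (Fin n) (Fin n) ℝ) (α τ : ℝ)
    (x : Fin (p + 2) → Fin n → ℝ) :
    Function.uncurry x ⬝ᵥ (PsiBar p R G α τ *ᵥ Function.uncurry x) =
      Real.exp (-2 * α * τ) * ∑ k : Fin (p + 1), ∑ l : Fin (p + 1), (x k.castSucc - x k.succ) ⬝ᵥ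
        ((if k = l then R else (1 / 2 : ℝ) • (G + Gᵀ)) *ᵥ (x l.castSucc - x l.succ)) := by
  rw [← dotProduct_Psi_mulVec p R G fun k => x k.castSucc - x k.succ, ← T_mulVec, PsiBar,
    smul_mulVec, dotProduct_smul, smul_eq_mul, ← mulVec_mulVec, ← mulVec_mulVec,
    dotProduct_transpose_mulVec, dotProduct_comm]

theorem Psi_transpose {p : ℕ} {R G : Matrix (Fin n) (Fin n) ℝ} (hR : Rᵀ = R) :
    (Psi p R G)ᵀ = Psi p R G := by
  ext a b
  simp only [Psi, transpose_apply, of_apply]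
  by_cases h : a.1 = b.1
  · rw [if_pos h.symm, if_pos h]
    exact congrFun (congrFun hR a.2) b.2
  · rw [if_neg (Ne.symm h), if_neg h]
    simp [add_comm]

theorem PsiBar_transpose {p : ℕ} {R G : Matrix (Fin n) (Fin n) ℝ} {α τ : ℝ} (hR : Rᵀ = R) :
    (PsiBar p R G α τ)ᵀ = PsiBar p R G α τ := by
  rw [PsiBar, transpose_smul, transpose_mul, transpose_mul, transpose_transpose, Psi_transpose hR,
    Matrix.mul_assoc]

/-- The vector `(b, c₁, …, c_p, d)`. -/
def stack {V : Type*} {p : ℕ} (b : V) (c : Fin p → V) (d : V) : Fin (p + 2) → V :=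
  Fin.cons (α := fun _ => V) b (Fin.snoc (α := fun _ => V) c d)

theorem sum_stack (p : ℕ) (f : Fin (p + 2) × Fin n → ℝ) :
    ∑ a, f a = ∑ a, f (i₁ p a) + ∑ a, f (i₂ p a) + ∑ a, f (i₃ p a) := by
  rw [Fintype.sum_prod_type, Fintype.sum_prod_type, Fin.sum_univ_succ, Fin.sum_univ_castSucc,
    ← add_assoc]
  rfl

theorem stack_i₁ {p : ℕ} (b : Fin n → ℝ) (c : Fin p → Fin n → ℝ) (d : Fin n → ℝ) (a : Fin n) :
    Function.uncurry (stack b c d) (i₁ p a) = b a := rfl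

theorem stack_i₂ {p : ℕ} (b : Fin n → ℝ) (c : Fin p → Fin n → ℝ) (d : Fin n → ℝ)
    (a : Fin p × Fin n) :
    Function.uncurry (stack b c d) (i₂ p a) = Function.uncurry c a := by
  simp [stack, i₂, Function.uncurry]

theorem stack_i₃ {p : ℕ} (b : Fin n → ℝ) (c : Fin p → Fin n → ℝ) (d : Fin n → ℝ) (a : Fin n) :
    Function.uncurry (stack b c d) (i₃ p a) = d a := by
  simp [stack, i₃, Function.uncurry, ← Fin.succ_last]

theorem quadratic_stack {p : ℕ} {M : Matrix (Fin (p + 2) × Fin n) (Fin (p + 2) × Fin n) ℝ}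
    (hM : Mᵀ = M) (b : Fin n → ℝ) (c : Fin p → Fin n → ℝ) (d : Fin n → ℝ) :
    Function.uncurry (stack b c d) ⬝ᵥ (M *ᵥ Function.uncurry (stack b c d)) =
      b ⬝ᵥ (M.submatrix (i₁ p) (i₁ p) *ᵥ b) +
      2 * (b ⬝ᵥ (M.submatrix (i₁ p) (i₂ p) *ᵥ Function.uncurry c)) +
      2 * (b ⬝ᵥ (M.submatrix (i₁ p) (i₃ p) *ᵥ d)) +
      Function.uncurry c ⬝ᵥ (M.submatrix (i₂ p) (i₂ p) *ᵥ Function.uncurry c) +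
      2 * (Function.uncurry c ⬝ᵥ (M.submatrix (i₂ p) (i₃ p) *ᵥ d)) +
      d ⬝ᵥ (M.submatrix (i₃ p) (i₃ p) *ᵥ d) := by
  have hsub : ∀ {γ δ : Type} (f : γ → Fin (p + 2) × Fin n) (g : δ → Fin (p + 2) × Fin n),
      M.submatrix f g = (M.submatrix g f)ᵀ := by
    intro γ δ f g
    rw [transpose_submatrix, hM]
  have hdot : ∀ x y : Fin (p + 2) × Fin n → ℝ, x ⬝ᵥ y = (x ∘ i₁ p) ⬝ᵥ (y ∘ i₁ p) +
      (x ∘ i₂ p) ⬝ᵥ (y ∘ i₂ p) + (x ∘ i₃ p) ⬝ᵥ (y ∘ i₃ p) := fun x y =>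
    sum_stack p fun a => x a * y a
  have hmul : ∀ {γ : Type} (f : γ → Fin (p + 2) × Fin n) (x : Fin (p + 2) × Fin n → ℝ),
      (M *ᵥ x) ∘ f = M.submatrix f (i₁ p) *ᵥ (x ∘ i₁ p) + M.submatrix f (i₂ p) *ᵥ (x ∘ i₂ p) +
        M.submatrix f (i₃ p) *ᵥ (x ∘ i₃ p) := by
    intro γ f x
    funext a
    exact hdot (M (f a)) x
  have h1 : Function.uncurry (stack b c d) ∘ i₁ p = b := funext (stack_i₁ b c d)
  have h2 : Function.uncurry (stack b c d) ∘ i₂ p = Function.uncurry c := funext (stack_i₂ b c d)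
  have h3 : Function.uncurry (stack b c d) ∘ i₃ p = d := funext (stack_i₃ b c d)
  rw [hdot, hmul, hmul, hmul, h1, h2, h3, hsub (i₂ p) (i₁ p), hsub (i₃ p) (i₁ p),
    hsub (i₃ p) (i₂ p)]
  simp only [dotProduct_add, dotProduct_transpose_mulVec]
  ring

end RRBlock

/-! ### The quadratic form of `Ξ̄_i` under the descriptor constraint -/

namespace RRDesign

open RRBlock

variable {N n mw mv : ℕ} {r h : Fin N → ℕ} (d : RRDesign N n r h) (net : RRNetwork N n mw mv r h)

/-- The vector on which the quadratic form of `Ξ̄_i` is evaluated. -/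
def stateVec (i : Fin N) (a b : Fin n → ℝ) (c : Fin (net.p i) → Fin n → ℝ) (z : Fin n → ℝ)
    (E f : net.nbr i → Fin n → ℝ) (x : Fin mw ⊕ Fin mv → ℝ) :
    Fin n ⊕ Fin n ⊕ (Fin (net.p i) × Fin n) ⊕ Fin n ⊕ (net.nbr i × Fin n) ⊕
      (net.nbr i × Fin n) ⊕ (Fin mw ⊕ Fin mv) → ℝ :=
  Sum.elim a (Sum.elim b (Sum.elim (Function.uncurry c) (Sum.elim z
    (Sum.elim (Function.uncurry E) (Sum.elim (Function.uncurry f) x)))))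

/-- In the application a = ė_i, b = e_i, c are the node's own samples, z = e_i(t - τ_i), E_j = e_j,
f_j are the held e_j, and x = ξ_i. The hypothesis `ha` is the error equation multiplied by X_i',
which makes the gains appear only through F_i and U_i. -/
theorem Xi_quadratic (γ : ℝ) (i : Fin N) (hR : (d.R i)ᵀ = d.R i)
    (hY : ((d.Y i)⁻¹)ᵀ = (d.Y i)⁻¹) (hW : ∀ j, (d.W j)ᵀ = d.W j)
    (a b : Fin n → ℝ) (c : Fin (net.p i) → Fin n → ℝ) (z : Fin n → ℝ)
    (E f : net.nbr i → Fin n → ℝ) (x : Fin mw ⊕ Fin mv → ℝ)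
    (ha : (d.X i)ᵀ *ᵥ a = ((d.X i)ᵀ * net.A - d.U i * net.C i) *ᵥ b +
      ((d.X i)ᵀ * net.B - d.U i * net.D i) *ᵥ x +
      (d.F i * net.H i) *ᵥ (∑ j, f j - ∑ l, c l)) :
    stateVec net i a b c z E f x ⬝ᵥ (d.Xi net γ i *ᵥ stateVec net i a b c z E f x) =
      2 * (b ⬝ᵥ ((d.Y i)⁻¹ *ᵥ a)) + 2 * d.α i * (b ⬝ᵥ ((d.Y i)⁻¹ *ᵥ b)) +
      net.τ i ^ 2 * (a ⬝ᵥ (d.R i *ᵥ a)) +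
      (∑ j ∈ net.outNbr i, net.τ j ^ 2) * (a ⬝ᵥ (d.W i *ᵥ a)) +
      (b ⬝ᵥ (d.S i *ᵥ b) - Real.exp (-2 * d.α i * net.τ i) * (z ⬝ᵥ (d.S i *ᵥ z))) -
      Function.uncurry (stack b c z) ⬝ᵥ (d.PsiBar net i *ᵥ Function.uncurry (stack b c z)) +
      (((net.p i : ℝ) + net.q i) / γ ^ 2 * (b ⬝ᵥ b) - 2 / γ ^ 2 * ∑ j, b ⬝ᵥ E j) -
      (∑ j : net.nbr i, d.pi j * (E j ⬝ᵥ ((d.Y j)⁻¹ *ᵥ E j))) -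
      (∑ j : net.nbr i, Real.pi ^ 2 / 4 * ((E j - f j) ⬝ᵥ (d.W j *ᵥ (E j - f j)))) -
      x ⬝ᵥ x := by
  have hAX : net.Aᵀ * d.X i = ((d.X i)ᵀ * net.A)ᵀ := by
    rw [transpose_mul, transpose_transpose]
  have hCU : (net.C i)ᵀ * (d.U i)ᵀ = (d.U i * net.C i)ᵀ := (transpose_mul _ _).symm
  have hHF : (net.H i)ᵀ * (d.F i)ᵀ = (d.F i * net.H i)ᵀ := (transpose_mul _ _).symm
  rw [quadratic_stack (M := d.PsiBar net i) (RRBlock.PsiBar_transpose hR)]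
  -- The three descriptor multipliers: e_i, ė_i and the sum of the held neighbour errors, weighted
  -- in the end by 1, ε_i and ε̄_i. The factor 2 there comes from symmetrization.
  have e1 := congrArg (fun v => b ⬝ᵥ v) ha
  have e2 := congrArg (fun v => a ⬝ᵥ v) ha
  have e3 := congrArg (fun v => (∑ j, f j) ⬝ᵥ v) ha
  unfold stateVec Xi
  simp only [sym_quadratic, fromCols_mulVec_elim]
  simp only [Xi_aa, Xi_ab, Xi_ac, Xi_af, Xi_ag, Xi_bb, Xi_bc, Xi_be, Xi_bf, Xi_bg, Xi_cf, Xi_ff,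
    Xi_fg, Phi₁₁, Phi₁₂, Phi₂₂, PsiT₁₁, PsiT₁₂, PsiT₁₃, PsiT₂₂, PsiT₂₃, PsiT₃₃, hAX, hCU, hHF]
  generalize d.PsiBar net i = Ψ
  generalize (d.X i)ᵀ * net.A = M₁ at *
  generalize d.U i * net.C i = M₂ at *
  generalize (d.X i)ᵀ * net.B = M₃ at *
  generalize d.U i * net.D i = M₄ at *
  generalize d.F i * net.H i = M₅ at *
  have hWs : ∀ j : net.nbr i, f j ⬝ᵥ (d.W j *ᵥ E j) = E j ⬝ᵥ (d.W j *ᵥ f j) := fun j =>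
    Matrix.dotProduct_mulVec_comm_of_transpose_eq (hW j) _ _
  have hYs : a ⬝ᵥ ((d.Y i)⁻¹ *ᵥ b) = b ⬝ᵥ ((d.Y i)⁻¹ *ᵥ a) :=
    Matrix.dotProduct_mulVec_comm_of_transpose_eq hY _ _
  simp only [add_mulVec, sub_mulVec, neg_mulVec, smul_mulVec, neg_smul, zero_mulVec, one_mulVec,
    dotProduct_add, dotProduct_sub, dotProduct_neg, dotProduct_smul, dotProduct_zero, smul_eq_mul,
    oneRow_mulVec, dotProduct_oneFull_mulVec, dotProduct_oneCol_mulVec, dotProduct_blkDiag_mulVec,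
    mulVec_sub, sub_dotProduct, dotProduct_transpose_mulVec, hYs, hWs,
    Finset.sum_add_distrib, Finset.sum_sub_distrib, ← Finset.mul_sum,
    ← dotProduct_sum] at e1 e2 e3 ⊢
  linear_combination (-2) * e1 - 2 * d.ε i * e2 - 2 * d.εbar i * e3

end RRDesign

/-! ### Bounds for quadratic forms -/

theorem exists_quadratic_le {ι : Type*} [Fintype ι] (Q : Matrix ι ι ℝ) :
    ∃ C, 0 ≤ C ∧ ∀ x : ι → ℝ, x ⬝ᵥ (Q *ᵥ x) ≤ C * (x ⬝ᵥ x) := by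
  refine ⟨∑ a, ∑ b, |Q a b|, by positivity, fun x => ?_⟩
  have hx : ∀ a, x a * x a ≤ x ⬝ᵥ x := fun a =>
    Finset.single_le_sum (f := fun a => x a * x a) (fun b _ => mul_self_nonneg _)
      (Finset.mem_univ a)
  generalize x ⬝ᵥ x = s at hx ⊢
  simp only [mulVec, dotProduct, Finset.mul_sum, Finset.sum_mul]
  refine Finset.sum_le_sum fun a _ => Finset.sum_le_sum fun b _ => ?_
  have h1 : x a * (Q a b * x b) ≤ |Q a b| * (|x a| * |x b|) := by
    rw [← abs_mul, ← abs_mul]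
    exact (le_abs_self _).trans_eq (by ring_nf)
  refine h1.trans (mul_le_mul_of_nonneg_left ?_ (abs_nonneg _))
  have h2 := hx a
  have h3 := hx b
  rw [← abs_mul_abs_self (x a)] at h2
  rw [← abs_mul_abs_self (x b)] at h3
  nlinarith [sq_nonneg (|x a| - |x b|)]

/-- The constant is the minimum of the form on the Euclidean unit sphere, written as x ⬝ᵥ x = 1
because the norm of the function space is the supremum norm. Homogeneity extends the bound to all
vectors. -/
theorem Matrix.PosDef.exists_le_quadratic {ι : Type*} [Fintype ι] {Q : Matrix ι ι ℝ}
    (hQ : Q.PosDef) : ∃ δ, 0 < δ ∧ ∀ x : ι → ℝ, δ * (x ⬝ᵥ x) ≤ x ⬝ᵥ (Q *ᵥ x) := by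
  classical
  rcases isEmpty_or_nonempty ι with hι | hι
  · exact ⟨1, one_pos, fun x => by simp [dotProduct]⟩
  set S : Set (ι → ℝ) := {x | x ⬝ᵥ x = 1} with hS
  have hSc : IsCompact S := by
    refine Metric.isCompact_of_isClosed_isBounded
      (isClosed_eq (by fun_prop) continuous_const) ?_
    refine (Metric.isBounded_closedBall (x := (0 : ι → ℝ)) (r := 1)).subset fun x hx => ?_
    rw [mem_closedBall_zero_iff, pi_norm_le_iff_of_nonneg zero_le_one]
    intro a
    have : x a * x a ≤ x ⬝ᵥ x := Finset.single_le_sum (f := fun a => x a * x a)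
      (fun b _ => mul_self_nonneg _) (Finset.mem_univ a)
    rw [hx] at this
    rw [Real.norm_eq_abs, abs_le]
    constructor <;> nlinarith
  have hne : S.Nonempty := ⟨Pi.single (Classical.arbitrary ι) 1, by simp [hS]⟩
  obtain ⟨y, hy, hmin⟩ := hSc.exists_isMinOn hne
    (f := fun x => x ⬝ᵥ (Q *ᵥ x)) (by fun_prop)
  have hy0 : y ≠ 0 := by
    rintro rfl
    simp [hS] at hy
  refine ⟨y ⬝ᵥ (Q *ᵥ y), by simpa using hQ.dotProduct_mulVec_pos hy0, fun x => ?_⟩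
  rcases eq_or_ne x 0 with rfl | hx
  · simp
  have hxx : 0 < x ⬝ᵥ x := by simpa using dotProduct_star_self_pos_iff.2 hx
  have hsq : Real.sqrt (x ⬝ᵥ x) * Real.sqrt (x ⬝ᵥ x) = x ⬝ᵥ x := Real.mul_self_sqrt hxx.le
  have hs0 : Real.sqrt (x ⬝ᵥ x) ≠ 0 := (Real.sqrt_pos.2 hxx).ne'
  have hmem : (Real.sqrt (x ⬝ᵥ x))⁻¹ • x ∈ S := by
    simp only [hS, Set.mem_ofPred_eq, smul_dotProduct, dotProduct_smul, smul_eq_mul]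
    nth_rewrite 3 [← hsq]
    field_simp
  have := hmin hmem
  simp only [Set.mem_ofPred_eq, smul_dotProduct, dotProduct_smul, smul_eq_mul, mulVec_smul] at this
  calc _ ≤ (Real.sqrt (x ⬝ᵥ x))⁻¹ * ((Real.sqrt (x ⬝ᵥ x))⁻¹ * (x ⬝ᵥ (Q *ᵥ x))) * (x ⬝ᵥ x) :=
        mul_le_mul_of_nonneg_right this hxx.le
    _ = _ := by
        nth_rewrite 3 [← hsq]
        field_simp

/-! ### Weighted integrals -/

/-- `f` has the integral `v` over `[a, b]` with respect to the weight `w`. -/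
def HasWeightedIntegral (w : ℝ → ℝ) (a b : ℝ) (f : ℝ → ℝ) (v : ℝ) : Prop :=
  IntervalIntegrable (fun u => w u * f u) volume a b ∧ ∫ u in a..b, w u * f u = v

namespace HasWeightedIntegral

variable {w : ℝ → ℝ} {a b : ℝ} {f g : ℝ → ℝ} {v v' : ℝ}

theorem add (hf : HasWeightedIntegral w a b f v) (hg : HasWeightedIntegral w a b g v') :
    HasWeightedIntegral w a b (fun u => f u + g u) (v + v') := by
  simp only [HasWeightedIntegral, mul_add]
  exact ⟨hf.1.add hg.1, by rw [intervalIntegral.integral_add hf.1 hg.1, hf.2, hg.2]⟩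

theorem sub (hf : HasWeightedIntegral w a b f v) (hg : HasWeightedIntegral w a b g v') :
    HasWeightedIntegral w a b (fun u => f u - g u) (v - v') := by
  simp only [HasWeightedIntegral, mul_sub]
  exact ⟨hf.1.sub hg.1, by rw [intervalIntegral.integral_sub hf.1 hg.1, hf.2, hg.2]⟩

theorem const_mul (c : ℝ) (hf : HasWeightedIntegral w a b f v) :
    HasWeightedIntegral w a b (fun u => c * f u) (c * v) := by
  simp only [HasWeightedIntegral, mul_left_comm _ c]
  exact ⟨hf.1.const_mul c, by rw [intervalIntegral.integral_const_mul, hf.2]⟩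

theorem sum {κ : Type*} {s : Finset κ} {f : κ → ℝ → ℝ} {v : κ → ℝ}
    (hf : ∀ i ∈ s, HasWeightedIntegral w a b (f i) (v i)) :
    HasWeightedIntegral w a b (fun u => ∑ i ∈ s, f i u) (∑ i ∈ s, v i) := by
  simp only [HasWeightedIntegral, Finset.mul_sum]
  refine ⟨IntervalIntegrable.fun_finsetSum fun i hi => (hf i hi).1, ?_⟩
  rw [intervalIntegral.integral_finsetSum fun i hi => (hf i hi).1]
  exact Finset.sum_congr rfl fun i hi => (hf i hi).2

theorem mono (hf : HasWeightedIntegral w a b f v) (hg : HasWeightedIntegral w a b g v')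
    (hab : a ≤ b) (hw : ∀ u, 0 ≤ w u) (h : ∀ u ∈ Set.Ioo a b, f u ≤ g u) : v ≤ v' := by
  rw [← hf.2, ← hg.2]
  exact intervalIntegral.integral_mono_on_of_le_Ioo hab hf.1 hg.1
    fun u hu => mul_le_mul_of_nonneg_left (h u hu) (hw u)

theorem nonneg (hf : HasWeightedIntegral w a b f v) (hab : a ≤ b) (hw : ∀ u, 0 ≤ w u)
    (h : ∀ u, 0 ≤ f u) : 0 ≤ v := by
  rw [← hf.2]
  exact intervalIntegral.integral_nonneg hab fun u _ => mul_nonneg (hw u) (h u)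

theorem of_intervalIntegrable (hw : Continuous w) (hf : IntervalIntegrable f volume a b) :
    HasWeightedIntegral w a b f (∫ u in a..b, w u * f u) :=
  ⟨hf.continuousOn_mul hw.continuousOn, rfl⟩

theorem of_continuous (hw : Continuous w) (hf : Continuous f) :
    HasWeightedIntegral w a b f (∫ u in a..b, w u * f u) :=
  of_intervalIntegrable hw (hf.intervalIntegrable a b)

end HasWeightedIntegral

/-! ### Wirtinger's inequality along a polled channel -/

namespace RRNetwork

variable {N n mw mv : ℕ} {r h : Fin N → ℕ} {net : RRNetwork N n mw mv r h}

theorem mem_nbr_iff {i j : Fin N} : j ∈ net.nbr i ↔ i ∈ net.outNbr j := by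
  simp [nbr, outNbr]

theorem sum_nbr_comm {M : Type*} [AddCommMonoid M] (f : Fin N → Fin N → M) :
    ∑ i, ∑ j ∈ net.nbr i, f i j = ∑ j, ∑ i ∈ net.outNbr j, f i j :=
  Finset.sum_comm' fun i j => by simp [mem_nbr_iff]

theorem intervalIntegrable_sub_held {f : ℝ → Fin n → ℝ} (hf : Continuous f) (i j : Fin N)
    (W : Matrix (Fin n) (Fin n) ℝ) (a b : ℝ) :
    IntervalIntegrable (fun u => (f u - net.held f i j u) ⬝ᵥ (W *ᵥ (f u - net.held f i j u)))
      volume a b := by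
  refine intervalIntegrable_quadratic_of_memLp
    (f := fun u => f u - net.held f i j u) (fun c => ?_) W
  exact (((continuous_apply c).comp hf).memLp_two_Ioc _ _).sub (net.memLp_held f i j c _ _)

/-- The weighted form of Wirtinger's inequality along a channel of the network. -/
theorem integral_held_nonneg {i j : Fin N} (hτ : BddAbove (Set.range (net.pollGap i)))
    (hj : j ∈ net.nbr i) {e g : ℝ → Fin n → ℝ} (hp : HasL2Deriv e g) {m : ℕ} {φ : Fin n → ℝ}
    (hφ : ∀ s ≤ net.t m, e s = φ) (hg : ∀ s ≤ net.t m, g s = 0)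
    {W : Matrix (Fin n) (Fin n) ℝ} (hW : W.PosSemidef) {β T : ℝ} (hβ : 0 ≤ β)
    (hT : net.t m ≤ T) :
    0 ≤ ∫ u in (net.t m)..T, Real.exp (2 * β * u) *
      (Real.exp (2 * β * net.τ i) * net.τ i ^ 2 * (g u ⬝ᵥ (W *ᵥ g u)) -
        Real.pi ^ 2 / 4 * ((e u - net.held e i j u) ⬝ᵥ (W *ᵥ (e u - net.held e i j u)))) := by
  set ρ : ℝ → ℝ := fun u => g u ⬝ᵥ (W *ᵥ g u) with hρ
  have hρ0 : ∀ u, 0 ≤ ρ u := fun u => hW.quadratic_nonneg _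
  have hρi : ∀ a b, IntervalIntegrable ρ volume a b := hp.intervalIntegrable_quadratic W
  have hec := hp.continuous
  set I : ℝ → ℝ := fun u => Real.exp (2 * β * u) *
      (Real.exp (2 * β * net.τ i) * net.τ i ^ 2 * ρ u -
        Real.pi ^ 2 / 4 * ((e u - net.held e i j u) ⬝ᵥ (W *ᵥ (e u - net.held e i j u)))) with hI
  have hIi : ∀ a b, IntervalIntegrable I volume a b := fun a b => by
    refine IntervalIntegrable.continuousOn_mul ?_ (by fun_prop)
    exact ((hρi a b).const_mul _).sub ((intervalIntegrable_sub_held hec i j W a b).const_mul _)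
  -- The unweighted Wirtinger integrand relative to the sample used on [t_k, t_{k+1}]. Its integral
  -- `V k t` starts at the sampling instant, which may precede t_k.
  set ζ : ℕ → ℝ → ℝ := fun k u => net.τ i ^ 2 * ρ u - Real.pi ^ 2 / 4 *
    ((e u - e (net.sampleTime i k j)) ⬝ᵥ (W *ᵥ (e u - e (net.sampleTime i k j)))) with hζ
  have hqc : ∀ v, Continuous fun u => (e u - v) ⬝ᵥ (W *ᵥ (e u - v)) := fun v => by fun_prop
  have hζi : ∀ k a b, IntervalIntegrable (ζ k) volume a b := fun k a b =>
    ((hρi a b).const_mul _).sub (((hqc _).intervalIntegrable a b).const_mul _)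
  set V : ℕ → ℝ → ℝ := fun k t => ∫ u in (net.sampleTime i k j)..t, ζ k u with hV
  have hVnonneg : ∀ k t, net.sampleTime i k j ≤ t → t ≤ net.t (k + 1) → 0 ≤ V k t := by
    intro k t h1 h2
    have h3 := hp.wirtinger hW h1 (τ := net.τ i) (by linarith [net.sub_sampleTime_le hτ hj k])
    rw [hV]
    simp only [hζ]
    rw [intervalIntegral.integral_sub ((hρi _ _).const_mul _)
      (((hqc _).intervalIntegrable _ _).const_mul _), intervalIntegral.integral_const_mul,
      intervalIntegral.integral_const_mul]
    linarith
  -- A weight frozen during the life of a sample. With s the sampling instant and s ≤ u ≤ s + τ, it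
  -- satisfies e^{2βu} ≤ κ ≤ e^{2βu} e^{2βτ}. The lower bound serves the negative term and the upper
  -- bound the positive one, which is why the factor e^{2βτ} stands only at τ² g'Wg.
  set κ : ℕ → ℝ := fun k =>
    Real.exp (2 * β * net.sampleTime i k j) * Real.exp (2 * β * net.τ i) with hκ
  have hκ0 : ∀ k, 0 ≤ κ k := fun k => by positivity
  -- The invariant is κ_k V_k(t) ≤ ∫ I over [t_m, t]. It propagates through a sampling interval
  -- since κ_k ζ_k ≤ I there.
  have hpiece : ∀ k, m ≤ k → κ k * V k (net.t k) ≤ ∫ u in (net.t m)..(net.t k), I u →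
      ∀ t ∈ Set.Icc (net.t k) (net.t (k + 1)), κ k * V k t ≤ ∫ u in (net.t m)..t, I u := by
    intro k hk hstart t ht
    have h1 : V k t = V k (net.t k) + ∫ u in (net.t k)..t, ζ k u :=
      (intervalIntegral.integral_add_adjacent_intervals (hζi _ _ _) (hζi _ _ _)).symm
    have h2 : ∫ u in (net.t m)..t, I u =
        (∫ u in (net.t m)..(net.t k), I u) + ∫ u in (net.t k)..t, I u :=
      (intervalIntegral.integral_add_adjacent_intervals (hIi _ _) (hIi _ _)).symm
    have h3 : ∫ u in (net.t k)..t, κ k * ζ k u ≤ ∫ u in (net.t k)..t, I u := by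
      refine intervalIntegral.integral_mono_on_of_le_Ioo ht.1 ((hζi _ _ _).const_mul _) (hIi _ _)
        fun u hu => ?_
      have h4 : net.idx u = k := net.idx_eq hu.1.le (hu.2.trans_le ht.2)
      have h5 : Real.exp (2 * β * u) ≤ κ k := by
        rw [hκ]
        simp only
        rw [← Real.exp_add]
        refine Real.exp_le_exp.2 ?_
        nlinarith [net.sub_sampleTime_le hτ hj k, hu.2, ht.2]
      have h6 : κ k ≤ Real.exp (2 * β * u) * Real.exp (2 * β * net.τ i) := by
        refine mul_le_mul_of_nonneg_right (Real.exp_le_exp.2 ?_) (Real.exp_pos _).le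
        nlinarith [net.sampleTime_le i j k, hu.1]
      simp only [hI, hζ, held, h4, mul_sub]
      refine sub_le_sub ?_ ?_
      · calc κ k * (net.τ i ^ 2 * ρ u) ≤
            Real.exp (2 * β * u) * Real.exp (2 * β * net.τ i) * (net.τ i ^ 2 * ρ u) :=
              mul_le_mul_of_nonneg_right h6 (mul_nonneg (sq_nonneg _) (hρ0 u))
          _ = _ := by ring
      · exact mul_le_mul_of_nonneg_right h5
          (mul_nonneg (by positivity) (hW.quadratic_nonneg _))
    rw [intervalIntegral.integral_const_mul] at h3
    rw [h1, h2, mul_add]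
    exact add_le_add hstart h3
  have hstart : ∀ k, m ≤ k → κ k * V k (net.t k) ≤ ∫ u in (net.t m)..(net.t k), I u := by
    intro k hk
    induction k, hk using Nat.le_induction with
    | base =>
      have hs := net.sampleTime_le i j m
      -- The sample in use at the start may predate t_m, but up to t_m the error is constant and its
      -- rate is zero.
      have : V m (net.t m) = 0 := by
        rw [hV]
        simp only
        rw [intervalIntegral.integral_congr (g := fun _ => 0)]
        · simp
        · intro u hu
          rw [Set.uIcc_of_le hs] at hu
          simp [hζ, hρ, hg u hu.2, hφ u hu.2, hφ _ hs]
      simp [this]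
    | succ k hk ih =>
      have hlt := (net.t_strictMono k.lt_succ_self).le
      have h1 := hpiece k hk ih (net.t (k + 1)) (Set.right_mem_Icc.2 hlt)
      -- If the channel keeps its sample, the invariant carries over unchanged. If it is polled, V
      -- restarts at zero, and the old value may be dropped because Wirtinger's inequality makes it
      -- nonnegative.
      rcases net.sampleTime_succ hj k with h2 | h2
      · have : κ (k + 1) * V (k + 1) (net.t (k + 1)) = κ k * V k (net.t (k + 1)) := by
          simp only [hκ, hV, hζ, h2]
        rw [this]
        exact h1
      · have : V (k + 1) (net.t (k + 1)) = 0 := by simp [hV, h2]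
        rw [this, mul_zero]
        exact (mul_nonneg (hκ0 k) (hVnonneg k _ ((net.sampleTime_le i j k).trans hlt) le_rfl)).trans
          h1
  have h1 := net.t_idx_le ((net.t_nonneg m).trans hT)
  have h2 := (net.lt_t_idx_succ T).le
  refine le_trans ?_ (hpiece _ (net.le_idx hT) (hstart _ (net.le_idx hT)) T ⟨h1, h2⟩)
  exact mul_nonneg (hκ0 _) (hVnonneg _ _ ((net.sampleTime_le i j _).trans h1) h2)

end RRNetwork

/-! ### The dissipation inequality of one node -/

namespace RRDesign

open RRBlock RRNetwork

variable {N n mw mv : ℕ} {r h : Fin N → ℕ} {d : RRDesign N n r h} {net : RRNetwork N n mw mv r h}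

theorem two_mul_le_of_posSemidef {R G : Matrix (Fin n) (Fin n) ℝ}
    (hRG : (fromBlocks R G Gᵀ R).PosSemidef) (x y : Fin n → ℝ) :
    2 * (x ⬝ᵥ (((1 / 2 : ℝ) • (G + Gᵀ)) *ᵥ y)) ≤ x ⬝ᵥ (R *ᵥ x) + y ⬝ᵥ (R *ᵥ y) := by
  have key : ∀ x y : Fin n → ℝ, 2 * (x ⬝ᵥ (G *ᵥ y)) ≤ x ⬝ᵥ (R *ᵥ x) + y ⬝ᵥ (R *ᵥ y) := by
    intro x y
    -- The sign of y turns nonnegativity of the block form into an upper bound for the cross term.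
    -- Averaging over both orders of x and y then symmetrizes G.
    have h : 0 ≤ Sum.elim x (-y) ⬝ᵥ (sym R G R *ᵥ Sum.elim x (-y)) := hRG.quadratic_nonneg _
    rw [sym_quadratic] at h
    simp only [mulVec_neg, dotProduct_neg, neg_dotProduct, neg_neg] at h
    linarith
  have h1 := key x y
  have h2 := key y x
  rw [smul_mulVec, add_mulVec, dotProduct_smul, dotProduct_add, dotProduct_transpose_mulVec,
    smul_eq_mul]
  linarith

/-- The bound of `Ψ̄_i` along a trajectory by the integral of its derivative. -/
theorem PsiBar_quadratic_le {i : Fin N} (hτ : BddAbove (Set.range (net.pollGap i)))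
    (hR : (d.R i).PosSemidef) (hRG : (fromBlocks (d.R i) (d.G i) (d.G i)ᵀ (d.R i)).PosSemidef)
    {e g : ℝ → Fin n → ℝ} (hp : HasL2Deriv e g) {u : ℝ} (hu : 0 ≤ u) :
    Function.uncurry (stack (e u) (fun l : Fin (net.p i) => e (net.t (net.idx u - l)))
        (e (u - net.τ i))) ⬝ᵥ (d.PsiBar net i *ᵥ Function.uncurry (stack (e u)
          (fun l : Fin (net.p i) => e (net.t (net.idx u - l))) (e (u - net.τ i)))) ≤
      Real.exp (-2 * d.α i * net.τ i) *
        (net.τ i * ∫ s in (u - net.τ i)..u, g s ⬝ᵥ (d.R i *ᵥ g s)) := by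
  set k := net.idx u with hk
  -- The decreasing chain u ≥ t_k ≥ … ≥ t_{k-p+1} ≥ u - τ_i of total length τ_i. Its increments are
  -- the differences formed by `T`.
  set s : ℕ → ℝ := fun l => if l = 0 then u else if l ≤ net.p i then net.t (k - (l - 1))
    else u - net.τ i with hs
  have hstack : ∀ l : Fin (net.p i + 2), stack (e u) (fun l : Fin (net.p i) => e (net.t (k - l)))
      (e (u - net.τ i)) l = e (s l) := by
    intro l
    induction l using Fin.cases with
    | zero => simp [stack, hs]
    | succ l =>
      induction l using Fin.lastCases with
      | last => simp [stack, hs]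
      | cast l => simp [stack, hs]
  have hanti : ∀ l < net.p i + 1, s (l + 1) ≤ s l := by
    intro l hl
    have h1 := net.t_idx_le hu
    have h2 := net.lt_t_idx_succ u
    have h3 := net.sub_le_τ hτ k
    rcases Nat.eq_zero_or_pos l with rfl | hl0
    · by_cases hp0 : 1 ≤ net.p i
      · simpa [hs, hp0] using h1
      · simpa [hs, hp0] using net.τ_nonneg i
    · by_cases hlp : l + 1 ≤ net.p i
      · have h4 : l ≤ net.p i := by omega
        simp only [hs, Nat.succ_ne_zero, if_false, hlp, if_true, hl0.ne', h4]
        exact net.t_strictMono.monotone (by omega)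
      · have h4 : l = net.p i := by omega
        -- The oldest sample has index k + 1 - p, also after truncation since p ≥ 1 here. With u <
        -- t_{k+1} the definition of τ_i puts it no earlier than u - τ_i.
        have h5 : k - (net.p i - 1) = k + 1 - net.p i := by omega
        simp only [hs, Nat.succ_ne_zero, if_false, hlp, hl0.ne', h4.le, if_true]
        rw [h4, h5]
        linarith
  have h := hp.reciprocally_convex hR (two_mul_le_of_posSemidef hRG) hanti
  have hs0 : s 0 = u := by simp [hs]
  have hsp : s (net.p i + 1) = u - net.τ i := by simp [hs]
  rw [hs0, hsp, sub_sub_cancel] at h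
  rw [RRDesign.PsiBar, dotProduct_PsiBar_mulVec]
  refine mul_le_mul_of_nonneg_left (le_trans (le_of_eq ?_) h) (Real.exp_pos _).le
  rw [Finset.sum_range]
  refine Finset.sum_congr rfl fun a _ => ?_
  rw [Finset.sum_range]
  refine Finset.sum_congr rfl fun b _ => ?_
  simp only [hstack, Fin.val_castSucc, Fin.val_succ, Fin.ext_iff]

/-- The dissipation inequality of node `i`. -/
theorem node_dissipation {γ : ℝ} (hd : d.Feasible net γ) {i : Fin N}
    (hτ : BddAbove (Set.range (net.pollGap i))) {δ : ℝ}
    (hδ0 : 0 ≤ δ) (hδ : ∀ x, δ * (x ⬝ᵥ x) ≤ x ⬝ᵥ ((-d.Xi net γ i) *ᵥ x))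
    {ξ : Fin N → ℝ → (Fin mw ⊕ Fin mv) → ℝ} {m : ℕ} {e g : Fin N → ℝ → Fin n → ℝ}
    (hg : g = net.errorRate d.K d.L ξ m e) (hp : HasL2Deriv (e i) (g i))
    {u : ℝ} (hu : net.t m < u) :
    2 * (e i u ⬝ᵥ ((d.Y i)⁻¹ *ᵥ g i u)) + 2 * d.α i * (e i u ⬝ᵥ ((d.Y i)⁻¹ *ᵥ e i u)) +
      net.τ i ^ 2 * (g i u ⬝ᵥ (d.R i *ᵥ g i u)) +
      (∑ j ∈ net.outNbr i, net.τ j ^ 2) * (g i u ⬝ᵥ (d.W i *ᵥ g i u)) +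
      (e i u ⬝ᵥ (d.S i *ᵥ e i u) - Real.exp (-2 * d.α i * net.τ i) *
        (e i (u - net.τ i) ⬝ᵥ (d.S i *ᵥ e i (u - net.τ i)))) -
      Real.exp (-2 * d.α i * net.τ i) * net.τ i *
        (∫ s in (u - net.τ i)..u, g i s ⬝ᵥ (d.R i *ᵥ g i s)) +
      (((net.p i : ℝ) + net.q i) / γ ^ 2 * (e i u ⬝ᵥ e i u) -
        2 / γ ^ 2 * ∑ j ∈ net.nbr i, e i u ⬝ᵥ e j u) -
      (∑ j ∈ net.nbr i, d.pi j * (e j u ⬝ᵥ ((d.Y j)⁻¹ *ᵥ e j u))) -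
      (∑ j ∈ net.nbr i, Real.pi ^ 2 / 4 * ((e j u - net.held (e j) i j u) ⬝ᵥ
        (d.W j *ᵥ (e j u - net.held (e j) i j u)))) -
      ξ i u ⬝ᵥ ξ i u + δ * (e i u ⬝ᵥ e i u + g i u ⬝ᵥ g i u) ≤ 0 := by
  obtain ⟨hY, hX, hS, hR, hW, hα, hpi, hq, hε, hεb, hRG, hXi⟩ := hd i
  have hu0 : 0 ≤ u := (net.t_nonneg m).trans hu.le
  set c : Fin (net.p i) → Fin n → ℝ := fun l => e i (net.t (net.idx u - l)) with hc
  set E : net.nbr i → Fin n → ℝ := fun j => e j u with hE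
  set f : net.nbr i → Fin n → ℝ := fun j => net.held (e j) i j u with hf
  have hXdet : IsUnit ((d.X i)ᵀ).det := by
    rw [det_transpose]
    exact isUnit_iff_ne_zero.2 hX
  have hXL : (d.X i)ᵀ * d.L i = d.U i := by
    rw [RRDesign.L, ← Matrix.mul_assoc, mul_nonsing_inv _ hXdet, Matrix.one_mul]
  have hXK : (d.X i)ᵀ * d.K i = d.F i := by
    rw [RRDesign.K, ← Matrix.mul_assoc, mul_nonsing_inv _ hXdet, Matrix.one_mul]
  have ha : (d.X i)ᵀ *ᵥ g i u = ((d.X i)ᵀ * net.A - d.U i * net.C i) *ᵥ e i u +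
      ((d.X i)ᵀ * net.B - d.U i * net.D i) *ᵥ ξ i u +
      (d.F i * net.H i) *ᵥ (∑ j, f j - ∑ l, c l) := by
    have hsum : ∑ j ∈ net.nbr i, (net.held (e j) i j u - net.held (e i) i j u) =
        ∑ j, f j - ∑ l, c l := by
      rw [Finset.sum_sub_distrib]
      congr 1
      · exact (Finset.sum_coe_sort (net.nbr i) fun j => net.held (e j) i j u).symm
      · rw [← Finset.sum_range fun l => e i (net.t (net.idx u - l))]
        exact net.sum_sampleTime i (net.idx u) (e i)
    rw [hg, errorRate_of_lt hu, hsum, mulVec_add, mulVec_add, mulVec_mulVec, mulVec_mulVec,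
      mulVec_mulVec, Matrix.mul_sub, Matrix.mul_sub, ← Matrix.mul_assoc, ← Matrix.mul_assoc,
      ← Matrix.mul_assoc, hXL, hXK]
  have hquad := d.Xi_quadratic net γ i hR.transpose_eq hY.inv.posSemidef.transpose_eq
    (fun j => (hd j).2.2.2.2.1.transpose_eq) (g i u) (e i u) c (e i (u - net.τ i)) E f (ξ i u) ha
  have hdef := hδ (stateVec net i (g i u) (e i u) c (e i (u - net.τ i)) E f (ξ i u))
  rw [neg_mulVec, dotProduct_neg, hquad] at hdef
  have hself : ∀ {κ : Type} [Fintype κ] (x : κ → ℝ), 0 ≤ x ⬝ᵥ x := fun x =>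
    Finset.sum_nonneg fun _ _ => mul_self_nonneg _
  -- Of the whole strictness margin only the parts for ė_i and e_i are kept. They are what the
  -- exponential weight has to be paid from.
  have hnorm : g i u ⬝ᵥ g i u + e i u ⬝ᵥ e i u ≤
      stateVec net i (g i u) (e i u) c (e i (u - net.τ i)) E f (ξ i u) ⬝ᵥ
        stateVec net i (g i u) (e i u) c (e i (u - net.τ i)) E f (ξ i u) := by
    unfold stateVec
    rw [sumElim_dotProduct_sumElim, sumElim_dotProduct_sumElim]
    linarith [hself (Sum.elim (Function.uncurry c) (Sum.elim (e i (u - net.τ i))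
      (Sum.elim (Function.uncurry E) (Sum.elim (Function.uncurry f) (ξ i u)))))]
  have hPsi := PsiBar_quadratic_le (d := d) hτ hR hRG hp hu0
  have h1 := mul_le_mul_of_nonneg_left hnorm hδ0
  have s1 : ∑ j, e i u ⬝ᵥ E j = ∑ j ∈ net.nbr i, e i u ⬝ᵥ e j u :=
    Finset.sum_coe_sort (net.nbr i) fun j => e i u ⬝ᵥ e j u
  have s2 : ∑ j : net.nbr i, d.pi j * (E j ⬝ᵥ ((d.Y j)⁻¹ *ᵥ E j)) =
      ∑ j ∈ net.nbr i, d.pi j * (e j u ⬝ᵥ ((d.Y j)⁻¹ *ᵥ e j u)) :=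
    Finset.sum_coe_sort (net.nbr i) fun j => d.pi j * (e j u ⬝ᵥ ((d.Y j)⁻¹ *ᵥ e j u))
  have s3 : ∑ j : net.nbr i, Real.pi ^ 2 / 4 * ((E j - f j) ⬝ᵥ (d.W j *ᵥ (E j - f j))) =
      ∑ j ∈ net.nbr i, Real.pi ^ 2 / 4 * ((e j u - net.held (e j) i j u) ⬝ᵥ
        (d.W j *ᵥ (e j u - net.held (e j) i j u))) :=
    Finset.sum_coe_sort (net.nbr i) fun j => Real.pi ^ 2 / 4 *
      ((e j u - net.held (e j) i j u) ⬝ᵥ (d.W j *ᵥ (e j u - net.held (e j) i j u)))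
  rw [s1, s2, s3] at hdef
  linarith

end RRDesign

/-! ### Weighted energy estimate for the network -/

namespace RRDesign

open RRBlock RRNetwork

variable {N n mw mv : ℕ} {r h : Fin N → ℕ} {d : RRDesign N n r h} {net : RRNetwork N n mw mv r h}

/-- Expanding ‖e_j - e_i‖² over all edges counts each ‖e_i‖² once per incoming and once per outgoing
edge, hence the coefficient p_i + q_i. -/
theorem sum_disagreement {γ : ℝ} (a : Fin N → ℝ) (b : Fin N → Fin N → ℝ) :
    ∑ i, (((net.p i : ℝ) + net.q i) / γ ^ 2 * a i - 2 / γ ^ 2 * ∑ j ∈ net.nbr i, b i j) =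
      1 / γ ^ 2 * ∑ i, ∑ j ∈ net.nbr i, (a j - 2 * b i j + a i) := by
  have h1 : ∑ i, ∑ j ∈ net.nbr i, a j = ∑ i, (net.q i : ℝ) * a i := by
    rw [sum_nbr_comm]
    exact Finset.sum_congr rfl fun j _ => by rw [Finset.sum_const, nsmul_eq_mul, q]
  have h2 : ∑ i, ∑ j ∈ net.nbr i, a i = ∑ i, (net.p i : ℝ) * a i :=
    Finset.sum_congr rfl fun j _ => by rw [Finset.sum_const, nsmul_eq_mul, p]
  have h3 : ∑ i, ∑ j ∈ net.nbr i, (a j - 2 * b i j + a i) =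
      ∑ i, ((net.q i : ℝ) * a i + net.p i * a i - 2 * ∑ j ∈ net.nbr i, b i j) := by
    simp only [Finset.sum_add_distrib, Finset.sum_sub_distrib, ← Finset.mul_sum, h1, h2]
    ring
  rw [h3, Finset.mul_sum]
  exact Finset.sum_congr rfl fun i _ => by ring

/-- The nodal inequality is integrated with weight w, and its delay terms are replaced by undelayed
ones. The R-terms then disappear, the S-terms leave an initial cost, and the W-terms of the
neighbours stay until the sum over the network is formed. -/
theorem dissipation_terms_le {γ : ℝ} (hd : d.Feasible net γ)
    (hτ : ∀ i, BddAbove (Set.range (net.pollGap i))) {δ : Fin N → ℝ} (hδ0 : ∀ i, 0 ≤ δ i)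
    (hδ : ∀ i x, δ i * (x ⬝ᵥ x) ≤ x ⬝ᵥ ((-d.Xi net γ i) *ᵥ x)) {β : ℝ} (hβ : 0 ≤ β)
    (hβα : ∀ i, β ≤ d.α i)
    {ξ : Fin N → ℝ → (Fin mw ⊕ Fin mv) → ℝ} {m : ℕ}
    (hξ : ∀ i c, MemLp (fun u => ξ i u c) 2 (volume.restrict (Set.Ioi (net.t m))))
    {φ : Fin N → Fin n → ℝ} {e : Fin N → ℝ → Fin n → ℝ}
    (he : net.IsErrorTrajectory d.K d.L ξ m φ e) {T : ℝ} (hT : net.t m ≤ T) (i : Fin N)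
    {w : ℝ → ℝ} (hw : w = fun u => Real.exp (2 * β * u))
    {g : Fin N → ℝ → Fin n → ℝ} (hg : g = net.errorRate d.K d.L ξ m e)
    {J : (ℝ → ℝ) → ℝ} (hJ : J = fun f => ∫ u in (net.t m)..T, w u * f u) :
    w T * (e i T ⬝ᵥ ((d.Y i)⁻¹ *ᵥ e i T)) - w (net.t m) * (φ i ⬝ᵥ ((d.Y i)⁻¹ *ᵥ φ i)) -
      2 * β * J (fun u => e i u ⬝ᵥ ((d.Y i)⁻¹ *ᵥ e i u)) +
      2 * d.α i * J (fun u => e i u ⬝ᵥ ((d.Y i)⁻¹ *ᵥ e i u)) +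
      (∑ j ∈ net.outNbr i, net.τ j ^ 2) * J (fun u => g i u ⬝ᵥ (d.W i *ᵥ g i u)) -
      Real.exp (-2 * (d.α i - β) * net.τ i) *
        (net.τ i * (w (net.t m) * (φ i ⬝ᵥ (d.S i *ᵥ φ i)))) +
      (((net.p i : ℝ) + net.q i) / γ ^ 2 * J (fun u => e i u ⬝ᵥ e i u) -
        2 / γ ^ 2 * ∑ j ∈ net.nbr i, J fun u => e i u ⬝ᵥ e j u) -
      (∑ j ∈ net.nbr i, d.pi j * J fun u => e j u ⬝ᵥ ((d.Y j)⁻¹ *ᵥ e j u)) -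
      (∑ j ∈ net.nbr i, Real.exp (2 * β * net.τ i) * net.τ i ^ 2 *
        J fun u => g j u ⬝ᵥ (d.W j *ᵥ g j u)) -
      J (fun u => ξ i u ⬝ᵥ ξ i u) +
      δ i * (J (fun u => e i u ⬝ᵥ e i u) + J fun u => g i u ⬝ᵥ g i u) ≤ 0 := by
  have hp : ∀ i, HasL2Deriv (e i) (g i) := fun i => hg ▸ he.hasL2Deriv hξ i
  have hec : ∀ i, Continuous (e i) := he.1
  have hφ : ∀ i, ∀ s ≤ net.t m, e i s = φ i := he.2.1
  have hg0 : ∀ i, ∀ s ≤ net.t m, g i s = 0 := fun i s hs => hg ▸ errorRate_of_le hs i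
  obtain ⟨hY, -, hS, hR, -, hα, -, -, -, -, -, -⟩ := hd i
  have hτ0 := net.τ_nonneg i
  have hwc : Continuous w := by rw [hw]; fun_prop
  have hw0 : ∀ u, 0 ≤ w u := fun u => by rw [hw]; exact (Real.exp_pos _).le
  have cont : ∀ {f : ℝ → ℝ}, Continuous f → HasWeightedIntegral w (net.t m) T f (J f) :=
    fun hf => hJ ▸ HasWeightedIntegral.of_continuous hwc hf
  have intg : ∀ {f : ℝ → ℝ}, IntervalIntegrable f volume (net.t m) T →
      HasWeightedIntegral w (net.t m) T f (J f) :=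
    fun hf => hJ ▸ HasWeightedIntegral.of_intervalIntegrable hwc hf
  have iY := (intg ((hp i).intervalIntegrable_bilinear (d.Y i)⁻¹ (hec i) _ _)).const_mul 2
  have cV : ∀ j, Continuous fun u => e j u ⬝ᵥ ((d.Y j)⁻¹ *ᵥ e j u) := fun j => by
    have := hec j
    fun_prop
  have iR := intg ((hp i).intervalIntegrable_quadratic (d.R i) _ _)
  have iW : ∀ j, HasWeightedIntegral w (net.t m) T _ _ := fun j =>
    intg ((hp j).intervalIntegrable_quadratic (d.W j) _ _)
  have cS : Continuous fun u => e i u ⬝ᵥ (d.S i *ᵥ e i u) := by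
    have := hec i
    fun_prop
  have cSd : Continuous fun u => e i u ⬝ᵥ (d.S i *ᵥ e i u) - Real.exp (-2 * d.α i * net.τ i) *
      (e i (u - net.τ i) ⬝ᵥ (d.S i *ᵥ e i (u - net.τ i))) :=
    cS.sub (continuous_const.mul (cS.comp (continuous_sub_right (net.τ i))))
  have hRi : ∀ a b, IntervalIntegrable (fun s => g i s ⬝ᵥ (d.R i *ᵥ g i s)) volume a b :=
    (hp i).intervalIntegrable_quadratic (d.R i)
  have cD : Continuous fun u => ∫ s in (u - net.τ i)..u, g i s ⬝ᵥ (d.R i *ᵥ g i s) :=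
    continuous_integral_delay hRi (net.τ i)
  have ce : ∀ j, Continuous fun u => e i u ⬝ᵥ e j u := fun j => by
    have := hec j
    have := hec i
    fun_prop
  have iζ : ∀ j, HasWeightedIntegral w (net.t m) T _ _ := fun j =>
    intg (intervalIntegrable_sub_held (net := net) (hec j) i j (d.W j) _ _)
  have iξ : HasWeightedIntegral w (net.t m) T (fun u => ξ i u ⬝ᵥ ξ i u)
      (J fun u => ξ i u ⬝ᵥ ξ i u) := intg (by
    have := intervalIntegrable_quadratic_of_memLp (a := net.t m) (b := T) (f := ξ i) (fun c => by
      rw [Set.uIoc_of_le hT]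
      exact (hξ i c).mono_measure (Measure.restrict_mono Set.Ioc_subset_Ioi_self le_rfl)) 1
    simpa only [one_mulVec] using this)
  have ig : HasWeightedIntegral w (net.t m) T (fun u => g i u ⬝ᵥ g i u)
      (J fun u => g i u ⬝ᵥ g i u) := intg (by
    simpa only [one_mulVec] using (hp i).intervalIntegrable_quadratic 1 (net.t m) T)
  have hsum := (((((((((iY.add ((cont (cV i)).const_mul (2 * d.α i))).add
    (iR.const_mul (net.τ i ^ 2))).add
    ((iW i).const_mul (∑ j ∈ net.outNbr i, net.τ j ^ 2))).add (cont cSd)).sub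
    ((cont cD).const_mul (Real.exp (-2 * d.α i * net.τ i) * net.τ i))).add
    (((cont (ce i)).const_mul (((net.p i : ℝ) + net.q i) / γ ^ 2)).sub
      ((HasWeightedIntegral.sum (s := net.nbr i) fun j _ => cont (ce j)).const_mul
        (2 / γ ^ 2)))).sub
    (HasWeightedIntegral.sum (s := net.nbr i) fun j _ => (cont (cV j)).const_mul (d.pi j))).sub
    (HasWeightedIntegral.sum (s := net.nbr i) fun j _ =>
      (iζ j).const_mul (Real.pi ^ 2 / 4))).sub iξ).add
    (((cont (ce i)).add ig).const_mul (δ i))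
  have hzero : HasWeightedIntegral w (net.t m) T (fun _ => 0) 0 := by simp [HasWeightedIntegral]
  -- The nodal inequality is available only for u > t_m, as the rate is set to zero at t_m.
  -- Comparison on the open interval suffices.
  have hle := hsum.mono hzero hT hw0 fun u hu =>
    node_dissipation hd (hτ i) (hδ0 i) (hδ i) hg (hp i) hu.1
  have hYeq : 2 * J (fun u => e i u ⬝ᵥ ((d.Y i)⁻¹ *ᵥ g i u)) =
      w T * (e i T ⬝ᵥ ((d.Y i)⁻¹ *ᵥ e i T)) - w (net.t m) * (φ i ⬝ᵥ ((d.Y i)⁻¹ *ᵥ φ i)) -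
      2 * β * J (fun u => e i u ⬝ᵥ ((d.Y i)⁻¹ *ᵥ e i u)) := by
    have hder : ∀ x ∈ Set.uIcc (net.t m) T, HasDerivAt w (2 * β * w x) x := fun x _ => by
      rw [hw]
      simpa [mul_comm] using ((hasDerivAt_id x).const_mul (2 * β)).exp
    have h1 := (hp i).integral_weighted_quadratic hY.inv.posSemidef.transpose_eq hder
      (by fun_prop)
    have h2 := iY.add ((cont (cV i)).const_mul (2 * β))
    rw [← hφ i (net.t m) le_rfl, ← h1, eq_sub_iff_add_eq, ← h2.2]
    exact intervalIntegral.integral_congr fun u _ => by ring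
  have hSge : -(Real.exp (-2 * (d.α i - β) * net.τ i) *
        (net.τ i * (w (net.t m) * (φ i ⬝ᵥ (d.S i *ᵥ φ i))))) ≤
      J fun u => e i u ⬝ᵥ (d.S i *ᵥ e i u) - Real.exp (-2 * d.α i * net.τ i) *
        (e i (u - net.τ i) ⬝ᵥ (d.S i *ᵥ e i (u - net.τ i))) := by
    rw [hJ, hw]
    exact integral_weighted_sub_delay_ge (σ := fun u => e i u ⬝ᵥ (d.S i *ᵥ e i u))
      (fun u => hS.quadratic_nonneg _) cS (fun u hu => by rw [hφ i u hu]) hT hτ0 hβ (hβα i)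
  have hRge : Real.exp (-2 * d.α i * net.τ i) * net.τ i *
        J (fun u => ∫ s in (u - net.τ i)..u, g i s ⬝ᵥ (d.R i *ᵥ g i s)) ≤
      net.τ i ^ 2 * J fun u => g i u ⬝ᵥ (d.R i *ᵥ g i u) := by
    have h1 : J (fun u => ∫ s in (u - net.τ i)..u, g i s ⬝ᵥ (d.R i *ᵥ g i s)) ≤
        Real.exp (2 * β * net.τ i) * (net.τ i * J fun u => g i u ⬝ᵥ (d.R i *ᵥ g i u)) := by
      rw [hJ, hw]
      exact integral_weighted_delay_le (fun u => hR.quadratic_nonneg _) hRi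
        (fun u hu => by simp [hg0 i u hu]) hT hτ0 hβ
    have h2 : 0 ≤ J fun u => g i u ⬝ᵥ (d.R i *ᵥ g i u) :=
      iR.nonneg hT hw0 fun u => hR.quadratic_nonneg _
    have h3 : Real.exp (-2 * d.α i * net.τ i) * Real.exp (2 * β * net.τ i) ≤ 1 := by
      rw [← Real.exp_add]
      refine Real.exp_le_one_iff.2 ?_
      nlinarith [mul_nonneg (sub_nonneg.2 (hβα i)) hτ0]
    calc _ ≤ Real.exp (-2 * d.α i * net.τ i) * net.τ i * (Real.exp (2 * β * net.τ i) *
          (net.τ i * J fun u => g i u ⬝ᵥ (d.R i *ᵥ g i u))) :=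
          mul_le_mul_of_nonneg_left h1 (mul_nonneg (Real.exp_pos _).le hτ0)
      _ = Real.exp (-2 * d.α i * net.τ i) * Real.exp (2 * β * net.τ i) *
          (net.τ i ^ 2 * J fun u => g i u ⬝ᵥ (d.R i *ᵥ g i u)) := by ring
      _ ≤ _ := mul_le_of_le_one_left (mul_nonneg (sq_nonneg _) h2) h3
  have hWge : ∑ j ∈ net.nbr i, Real.pi ^ 2 / 4 * J (fun u => (e j u - net.held (e j) i j u) ⬝ᵥ
        (d.W j *ᵥ (e j u - net.held (e j) i j u))) ≤
      ∑ j ∈ net.nbr i, Real.exp (2 * β * net.τ i) * net.τ i ^ 2 *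
        J fun u => g j u ⬝ᵥ (d.W j *ᵥ g j u) := by
    refine Finset.sum_le_sum fun j hj => ?_
    have h1 := integral_held_nonneg (hτ i) hj (hp j) (hφ j) (hg0 j) (hd j).2.2.2.2.1 hβ hT
    have h2 := (((iW j).const_mul (Real.exp (2 * β * net.τ i) * net.τ i ^ 2)).sub
      ((iζ j).const_mul (Real.pi ^ 2 / 4))).2
    rw [hw] at h2
    rw [h2] at h1
    linarith
  linarith

/-- The weighted energy estimate for the interconnected error system. -/
theorem energy_le {γ : ℝ} (hd : d.Feasible net γ)
    (hτ : ∀ i, BddAbove (Set.range (net.pollGap i))) {δ : Fin N → ℝ} (hδ0 : ∀ i, 0 ≤ δ i)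
    (hδ : ∀ i x, δ i * (x ⬝ᵥ x) ≤ x ⬝ᵥ ((-d.Xi net γ i) *ᵥ x)) {β : ℝ} (hβ : 0 ≤ β)
    (hβα : ∀ i, β ≤ d.α i)
    (hβY : ∀ i (x : Fin n → ℝ), 2 * β * (x ⬝ᵥ ((d.Y i)⁻¹ *ᵥ x)) ≤ δ i * (x ⬝ᵥ x))
    (hβW : ∀ i (x : Fin n → ℝ), (∑ j ∈ net.outNbr i, (Real.exp (2 * β * net.τ j) - 1) *
      net.τ j ^ 2) * (x ⬝ᵥ (d.W i *ᵥ x)) ≤ δ i * (x ⬝ᵥ x))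
    {ξ : Fin N → ℝ → (Fin mw ⊕ Fin mv) → ℝ} {m : ℕ}
    (hξ : ∀ i c, MemLp (fun u => ξ i u c) 2 (volume.restrict (Set.Ioi (net.t m))))
    {φ : Fin N → Fin n → ℝ} {e : Fin N → ℝ → Fin n → ℝ}
    (he : net.IsErrorTrajectory d.K d.L ξ m φ e) {T : ℝ} (hT : net.t m ≤ T) :
    Real.exp (2 * β * T) * ∑ i, e i T ⬝ᵥ ((d.Y i)⁻¹ *ᵥ e i T) +
        1 / γ ^ 2 * ∫ u in (net.t m)..T, Real.exp (2 * β * u) * net.disagreement e u ≤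
      Real.exp (2 * β * net.t m) * ∑ i, (φ i ⬝ᵥ ((d.Y i)⁻¹ *ᵥ φ i) +
        Real.exp (-2 * (d.α i - β) * net.τ i) * net.τ i * (φ i ⬝ᵥ (d.S i *ᵥ φ i))) +
      ∑ i, ∫ u in (net.t m)..T, Real.exp (2 * β * u) * (ξ i u ⬝ᵥ ξ i u) := by
  obtain ⟨w, hw⟩ : ∃ w : ℝ → ℝ, w = fun u => Real.exp (2 * β * u) := ⟨_, rfl⟩
  obtain ⟨g, hg⟩ : ∃ g, g = net.errorRate d.K d.L ξ m e := ⟨_, rfl⟩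
  obtain ⟨J, hJ⟩ : ∃ J : (ℝ → ℝ) → ℝ, J = fun f => ∫ u in (net.t m)..T, w u * f u := ⟨_, rfl⟩
  have key := fun i => dissipation_terms_le hd hτ hδ0 hδ hβ hβα hξ he hT i hw hg hJ
  have hp : ∀ i, HasL2Deriv (e i) (g i) := fun i => hg ▸ he.hasL2Deriv hξ i
  have hec : ∀ i, Continuous (e i) := he.1
  have hwc : Continuous w := by rw [hw]; fun_prop
  have hw0 : ∀ u, 0 ≤ w u := fun u => by rw [hw]; exact (Real.exp_pos _).le
  have cont : ∀ {f : ℝ → ℝ}, Continuous f → HasWeightedIntegral w (net.t m) T f (J f) :=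
    fun hf => hJ ▸ HasWeightedIntegral.of_continuous hwc hf
  have intg : ∀ {f : ℝ → ℝ}, IntervalIntegrable f volume (net.t m) T →
      HasWeightedIntegral w (net.t m) T f (J f) :=
    fun hf => hJ ▸ HasWeightedIntegral.of_intervalIntegrable hwc hf
  have iV : ∀ j, HasWeightedIntegral w (net.t m) T (fun u => e j u ⬝ᵥ ((d.Y j)⁻¹ *ᵥ e j u)) _ :=
    fun j => by
      have := hec j
      exact cont (by fun_prop)
  have ie : ∀ i j, HasWeightedIntegral w (net.t m) T (fun u => e i u ⬝ᵥ e j u) _ := fun i j => by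
    have := hec i
    have := hec j
    exact cont (by fun_prop)
  have iW : ∀ j, HasWeightedIntegral w (net.t m) T _ _ := fun j =>
    intg ((hp j).intervalIntegrable_quadratic (d.W j) _ _)
  have ig : ∀ i, HasWeightedIntegral w (net.t m) T (fun u => g i u ⬝ᵥ g i u) _ := fun i => intg (by
    simpa only [one_mulVec] using (hp i).intervalIntegrable_quadratic 1 (net.t m) T)
  have hV0 : ∀ i, 0 ≤ J fun u => e i u ⬝ᵥ ((d.Y i)⁻¹ *ᵥ e i u) := fun i =>
    (iV i).nonneg hT hw0 fun u => (hd i).1.inv.posSemidef.quadratic_nonneg _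
  -- The slack δ_i‖e_i‖² pays for differentiating the weight in e^{2βt}V_i. The slack δ_i‖ė_i‖² pays
  -- below for the excess factor e^{2βτ_j} in the Wirtinger terms.
  have hslackY : ∀ i, 2 * β * J (fun u => e i u ⬝ᵥ ((d.Y i)⁻¹ *ᵥ e i u)) ≤
      δ i * J fun u => e i u ⬝ᵥ e i u := fun i =>
    ((iV i).const_mul _).mono ((ie i i).const_mul _) hT hw0 fun u _ => hβY i (e i u)
  have hslackW : ∀ i, (∑ j ∈ net.outNbr i, (Real.exp (2 * β * net.τ j) - 1) * net.τ j ^ 2) *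
      J (fun u => g i u ⬝ᵥ (d.W i *ᵥ g i u)) ≤ δ i * J fun u => g i u ⬝ᵥ g i u := fun i =>
    ((iW i).const_mul _).mono ((ig i).const_mul _) hT hw0 fun u _ => hβW i (g i u)
  have hdis : J (net.disagreement e) = ∑ i, ∑ j ∈ net.nbr i,
      ((J fun u => e j u ⬝ᵥ e j u) - 2 * (J fun u => e i u ⬝ᵥ e j u) +
        J fun u => e i u ⬝ᵥ e i u) := by
    have h1 := HasWeightedIntegral.sum (s := Finset.univ) fun i _ =>
      HasWeightedIntegral.sum (s := net.nbr i) fun j _ =>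
        ((ie j j).sub ((ie i j).const_mul 2)).add (ie i i)
    rw [← h1.2, hJ]
    refine intervalIntegral.integral_congr fun u _ => ?_
    simp only [disagreement]
    congr 1
    refine Finset.sum_congr rfl fun i _ => Finset.sum_congr rfl fun j _ => ?_
    simp only [sub_dotProduct, dotProduct_sub, dotProduct_comm (e j u) (e i u)]
    ring
  -- Reindexed by the source of the edge, V_j occurs q_j times with factor π_j, and q_jπ_j < 2α_j.
  have hpisum : ∑ i, ∑ j ∈ net.nbr i, d.pi j * J (fun u => e j u ⬝ᵥ ((d.Y j)⁻¹ *ᵥ e j u)) ≤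
      ∑ i, 2 * d.α i * J (fun u => e i u ⬝ᵥ ((d.Y i)⁻¹ *ᵥ e i u)) := by
    rw [sum_nbr_comm]
    refine Finset.sum_le_sum fun i _ => ?_
    rw [Finset.sum_const, nsmul_eq_mul, ← mul_assoc]
    exact mul_le_mul_of_nonneg_right (hd i).2.2.2.2.2.2.2.1.le (hV0 i)
  -- Splitting e^{2βτ_j} = (e^{2βτ_j} - 1) + 1 separates the part cancelled by the W_i-term of
  -- `Ξ̄_i` from the part left to the slack.
  have hWsum : ∑ i, ∑ j ∈ net.nbr i, Real.exp (2 * β * net.τ i) * net.τ i ^ 2 *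
        J (fun u => g j u ⬝ᵥ (d.W j *ᵥ g j u)) =
      ∑ i, ((∑ j ∈ net.outNbr i, (Real.exp (2 * β * net.τ j) - 1) * net.τ j ^ 2) *
        J (fun u => g i u ⬝ᵥ (d.W i *ᵥ g i u)) +
        (∑ j ∈ net.outNbr i, net.τ j ^ 2) * J fun u => g i u ⬝ᵥ (d.W i *ᵥ g i u)) := by
    rw [sum_nbr_comm]
    refine Finset.sum_congr rfl fun i _ => ?_
    rw [← add_mul, ← Finset.sum_add_distrib, Finset.sum_mul]
    exact Finset.sum_congr rfl fun j _ => by ring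
  have hdeg := sum_disagreement (net := net) (γ := γ) (fun i => J fun u => e i u ⬝ᵥ e i u)
    fun i j => J fun u => e i u ⬝ᵥ e j u
  rw [← hdis] at hdeg
  have hWslack := Finset.sum_le_sum fun i (_ : i ∈ Finset.univ) => hslackW i
  have hYslack := Finset.sum_le_sum fun i (_ : i ∈ Finset.univ) => hslackY i
  have htotal := Finset.sum_nonpos fun i (_ : i ∈ Finset.univ) => key i
  have hgoal : w T * ∑ i, e i T ⬝ᵥ ((d.Y i)⁻¹ *ᵥ e i T) + 1 / γ ^ 2 * J (net.disagreement e) ≤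
      w (net.t m) * ∑ i, (φ i ⬝ᵥ ((d.Y i)⁻¹ *ᵥ φ i) +
        Real.exp (-2 * (d.α i - β) * net.τ i) * net.τ i * (φ i ⬝ᵥ (d.S i *ᵥ φ i))) +
      ∑ i, J fun u => ξ i u ⬝ᵥ ξ i u := by
    have hS : ∑ i, Real.exp (-2 * (d.α i - β) * net.τ i) *
        (net.τ i * (w (net.t m) * (φ i ⬝ᵥ (d.S i *ᵥ φ i)))) = w (net.t m) *
        ∑ i, Real.exp (-2 * (d.α i - β) * net.τ i) * net.τ i * (φ i ⬝ᵥ (d.S i *ᵥ φ i)) := by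
      rw [Finset.mul_sum]
      exact Finset.sum_congr rfl fun i _ => by ring
    simp only [Finset.sum_add_distrib, Finset.sum_sub_distrib, ← Finset.mul_sum, mul_add,
      hS] at htotal hdeg hWsum hWslack hYslack hpisum ⊢
    linarith
  rw [hJ, hw] at hgoal
  exact hgoal

end RRDesign

/-! ### From plant and observers to the error system -/

theorem intervalIntegrable_mulVec {ι κ : Type*} [Fintype ι] [Fintype κ] (M : Matrix ι κ ℝ)
    {f : ℝ → κ → ℝ} (hf : ∀ c, MemLp (fun u => f u c) 2 (volume.restrict (Set.Ioi 0))) {a b : ℝ}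
    (ha : 0 ≤ a) (hab : a ≤ b) : IntervalIntegrable (fun u => M *ᵥ f u) volume a b := by
  rw [intervalIntegrable_iff_integrableOn_Ioc_of_le hab]
  refine Integrable.of_eval fun c => (memLp_mulVec M (fun d => ?_) c).integrable (by norm_num)
  refine (hf d).mono_measure (Measure.restrict_mono (fun u hu => ?_) le_rfl)
  exact ha.trans_lt hu.1

namespace RRNetwork

variable {N n mw mv : ℕ} {r h : Fin N → ℕ} {net : RRNetwork N n mw mv r h}

/-- The estimation errors satisfy the error equations. -/
theorem isErrorTrajectory_sub {K : ∀ i, Matrix (Fin n) (Fin (h i)) ℝ}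
    {L : ∀ i, Matrix (Fin n) (Fin (r i)) ℝ} {x₀ : Fin n → ℝ} {w : ℝ → Fin mw → ℝ}
    {v : Fin N → ℝ → Fin mv → ℝ} {x : ℝ → Fin n → ℝ} {xh : Fin N → ℝ → Fin n → ℝ}
    (hξ : ∀ i c, MemLp (fun u => Sum.elim (w u) (v i u) c) 2 (volume.restrict (Set.Ioi 0)))
    (hw : ∀ c, MemLp (fun u => w u c) 2 (volume.restrict (Set.Ioi 0)))
    (hx : net.IsPlantTrajectory x₀ w x) (hxh : net.IsObserverTrajectory K L (net.y x w v) xh) :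
    net.IsErrorTrajectory K L (fun i u => Sum.elim (w u) (v i u)) 0 (fun _ => x₀)
      fun i u => x u - xh i u := by
  obtain ⟨hxc, hx0, hxe⟩ := hx
  obtain ⟨hhc, hh0, hhe⟩ := hxh
  refine ⟨fun i => hxc.sub (hhc i), fun i s hs => ?_, fun i k _ s hs => ?_⟩
  · rw [net.t_zero] at hs
    simp only [hx0 s hs, hh0 i s hs, sub_zero]
  have htk := net.t_nonneg k
  have hplant : ∀ a b, 0 ≤ a → a ≤ b →
      IntervalIntegrable (fun u => net.A *ᵥ x u + net.B₂ *ᵥ w u) volume a b := fun a b ha hab =>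
    ((continuous_const.matrix_mulVec hxc).intervalIntegrable a b).add
      (intervalIntegrable_mulVec net.B₂ hw ha hab)
  have hxs : x s = x (net.t k) + ∫ u in (net.t k)..s, (net.A *ᵥ x u + net.B₂ *ᵥ w u) := by
    rw [hxe s (htk.trans hs.1), hxe _ htk, add_assoc,
      intervalIntegral.integral_add_adjacent_intervals (hplant _ _ le_rfl htk)
        (hplant _ _ htk hs.1)]
  have herr : IntervalIntegrable (fun u => (net.A - L i * net.C i) *ᵥ (x u - xh i u) +
      (net.B - L i * net.D i) *ᵥ Sum.elim (w u) (v i u) +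
          (K i * net.H i) *ᵥ ∑ j ∈ net.nbr i,
            ((x (net.sampleTime i k j) - xh j (net.sampleTime i k j)) -
              (x (net.sampleTime i k j) - xh i (net.sampleTime i k j)))) volume (net.t k) s :=
    (((continuous_const.matrix_mulVec (hxc.sub (hhc i))).intervalIntegrable _ _).add
      (intervalIntegrable_mulVec _ (hξ i) htk hs.1)).add intervalIntegrable_const
  -- The observer rate is the plant rate minus the error rate. Splitting the integral is legitimate
  -- because both of the latter are integrable.
  have hobs : (∫ u in (net.t k)..s, (net.A *ᵥ xh i u +
        L i *ᵥ (net.y x w v i u - net.C i *ᵥ xh i u) + K i *ᵥ ∑ j ∈ net.nbr i,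
          net.H i *ᵥ (xh j (net.sampleTime i k j) - xh i (net.sampleTime i k j)))) =
      (∫ u in (net.t k)..s, (net.A *ᵥ x u + net.B₂ *ᵥ w u)) - ∫ u in (net.t k)..s,
        ((net.A - L i * net.C i) *ᵥ (x u - xh i u) +
          (net.B - L i * net.D i) *ᵥ Sum.elim (w u) (v i u) +
          (K i * net.H i) *ᵥ ∑ j ∈ net.nbr i,
            ((x (net.sampleTime i k j) - xh j (net.sampleTime i k j)) -
              (x (net.sampleTime i k j) - xh i (net.sampleTime i k j)))) := by
    rw [← intervalIntegral.integral_sub (hplant _ _ htk hs.1) herr]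
    refine intervalIntegral.integral_congr fun u _ => ?_
    have hsum : ∑ j ∈ net.nbr i, ((x (net.sampleTime i k j) - xh j (net.sampleTime i k j)) -
        (x (net.sampleTime i k j) - xh i (net.sampleTime i k j))) =
        -∑ j ∈ net.nbr i, (xh j (net.sampleTime i k j) - xh i (net.sampleTime i k j)) := by
      rw [← Finset.sum_neg_distrib]
      exact Finset.sum_congr rfl fun j _ => by abel
    have hH : ∑ j ∈ net.nbr i,
        net.H i *ᵥ (xh j (net.sampleTime i k j) - xh i (net.sampleTime i k j)) =
        net.H i *ᵥ ∑ j ∈ net.nbr i,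
          (xh j (net.sampleTime i k j) - xh i (net.sampleTime i k j)) := by
      rw [mulVec_sum]
    simp only [hsum, hH]
    generalize ∑ j ∈ net.nbr i, (xh j (net.sampleTime i k j) - xh i (net.sampleTime i k j)) = z
    simp only [y, B, D, sub_mulVec, mulVec_sub, mulVec_add, mulVec_neg, ← mulVec_mulVec,
      RRBlock.fromCols_mulVec_elim, zero_mulVec]
    abel
  beta_reduce
  rw [hhe i k s hs, hobs, hxs]
  abel

theorem disagreement_sub (x : ℝ → Fin n → ℝ) (xh : Fin N → ℝ → Fin n → ℝ) :
    net.disagreement (fun i u => x u - xh i u) = net.disagreement xh := by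
  funext u
  refine Finset.sum_congr rfl fun i _ => Finset.sum_congr rfl fun j _ => ?_
  rw [sub_sub_sub_cancel_left, ← neg_sub, neg_dotProduct_neg]

theorem disagreement_nonneg (e : Fin N → ℝ → Fin n → ℝ) (u : ℝ) : 0 ≤ net.disagreement e u :=
  Finset.sum_nonneg fun _ _ => Finset.sum_nonneg fun _ _ =>
    Finset.sum_nonneg fun _ _ => mul_self_nonneg _

end RRNetwork

/-! ### Exponential stability and consensus performance -/

namespace RRDesign

open RRBlock RRNetwork

variable {N n mw mv : ℕ} {r h : Fin N → ℕ} {d : RRDesign N n r h} {net : RRNetwork N n mw mv r h}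

/-- At β = 0 the conditions read 0 < α_i and 0 < δ_i. There are finitely many of them and both sides
are continuous in β, so they persist for small β > 0. -/
theorem exists_decay_rate {γ : ℝ} (hd : d.Feasible net γ) {δ CY CW : Fin N → ℝ}
    (hδ : ∀ i, 0 < δ i) :
    ∃ β > 0, ∀ i, β ≤ d.α i ∧ 2 * β * CY i ≤ δ i ∧
      (∑ j ∈ net.outNbr i, (Real.exp (2 * β * net.τ j) - 1) * net.τ j ^ 2) * CW i ≤ δ i := by
  have hev : ∀ᶠ β in nhdsWithin (0 : ℝ) (Set.Ioi 0), ∀ i, β ≤ d.α i ∧ 2 * β * CY i ≤ δ i ∧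
      (∑ j ∈ net.outNbr i, (Real.exp (2 * β * net.τ j) - 1) * net.τ j ^ 2) * CW i ≤ δ i := by
    refine nhdsWithin_le_nhds (Filter.eventually_all.2 fun i => ?_)
    have h1 : ∀ᶠ β : ℝ in nhds 0, β < d.α i := gt_mem_nhds (hd i).2.2.2.2.2.1
    have h2 : ∀ᶠ β : ℝ in nhds 0, 2 * β * CY i < δ i := by
      have : Continuous fun β : ℝ => 2 * β * CY i := by fun_prop
      exact this.continuousAt.eventually_lt continuousAt_const (by simpa using hδ i)
    have h3 : ∀ᶠ β : ℝ in nhds 0,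
        (∑ j ∈ net.outNbr i, (Real.exp (2 * β * net.τ j) - 1) * net.τ j ^ 2) * CW i < δ i := by
      have : Continuous fun β : ℝ =>
          (∑ j ∈ net.outNbr i, (Real.exp (2 * β * net.τ j) - 1) * net.τ j ^ 2) * CW i := by fun_prop
      exact this.continuousAt.eventually_lt continuousAt_const (by simpa using hδ i)
    filter_upwards [h1, h2, h3] with β hβ1 hβ2 hβ3
    exact ⟨hβ1.le, hβ2.le, hβ3.le⟩
  obtain ⟨β, hβ, hβ0⟩ := (hev.and self_mem_nhdsWithin).exists
  exact ⟨β, hβ0, hβ⟩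

theorem exponentiallyStable {γ : ℝ} (hd : d.Feasible net γ)
    (hτ : ∀ i, BddAbove (Set.range (net.pollGap i))) : net.ExponentiallyStable d.K d.L := by
  have hself : ∀ x : Fin n → ℝ, 0 ≤ x ⬝ᵥ x := fun x =>
    Finset.sum_nonneg fun _ _ => mul_self_nonneg _
  have hYpd : ∀ i, (d.Y i)⁻¹.PosDef := fun i => (hd i).1.inv
  choose δ hδ0 hδ using fun i => (hd i).2.2.2.2.2.2.2.2.2.2.2.exists_le_quadratic
  choose l hl0 hl using fun i => (hYpd i).exists_le_quadratic
  choose CY hCY0 hCY using fun i => exists_quadratic_le (d.Y i)⁻¹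
  choose CS hCS0 hCS using fun i => exists_quadratic_le (d.S i)
  choose CW hCW0 hCW using fun i => exists_quadratic_le (d.W i)
  obtain ⟨β, hβ0, hβ⟩ := exists_decay_rate (CY := CY) (CW := CW) hd hδ0
  set Λ : ℝ := ∑ i, (l i)⁻¹ with hΛ
  set C : ℝ := ∑ i, (CY i + net.τ i * CS i) with hC
  have hΛ0 : 0 ≤ Λ := Finset.sum_nonneg fun i _ => (inv_pos.2 (hl0 i)).le
  have hCi : ∀ i, 0 ≤ CY i + net.τ i * CS i := fun i =>
    add_nonneg (hCY0 i) (mul_nonneg (net.τ_nonneg i) (hCS0 i))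
  have hC0 : 0 ≤ C := Finset.sum_nonneg fun i _ => hCi i
  -- Λ converts the forms of Y_i⁻¹ back to squared norms and C bounds the initial cost. The added 1
  -- keeps the constant positive even when Λ C vanishes.
  refine ⟨Λ * C + 1, by positivity, β, hβ0, fun m φ e he s hs => ?_⟩
  have hen := energy_le hd hτ (fun i => (hδ0 i).le) hδ hβ0.le (fun i => (hβ i).1)
    (fun i x => ?_) (fun i x => ?_) (fun i c => by simp) he hs
  rotate_left
  · calc 2 * β * (x ⬝ᵥ ((d.Y i)⁻¹ *ᵥ x)) ≤ 2 * β * (CY i * (x ⬝ᵥ x)) :=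
          mul_le_mul_of_nonneg_left (hCY i x) (by positivity)
      _ = 2 * β * CY i * (x ⬝ᵥ x) := by ring
      _ ≤ _ := mul_le_mul_of_nonneg_right (hβ i).2.1 (hself x)
  · have h0 : 0 ≤ ∑ j ∈ net.outNbr i, (Real.exp (2 * β * net.τ j) - 1) * net.τ j ^ 2 := by
      refine Finset.sum_nonneg fun j _ => mul_nonneg (sub_nonneg.2 (Real.one_le_exp ?_))
        (sq_nonneg _)
      have := net.τ_nonneg j
      positivity
    calc _ ≤ _ := mul_le_mul_of_nonneg_left (hCW i x) h0
      _ = _ := (mul_assoc _ _ _).symm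
      _ ≤ _ := mul_le_mul_of_nonneg_right (hβ i).2.2 (hself x)
  have hφ0 : 0 ≤ ∑ i, φ i ⬝ᵥ φ i := Finset.sum_nonneg fun i _ => hself _
  have hdis : 0 ≤ 1 / γ ^ 2 *
      ∫ u in (net.t m)..s, Real.exp (2 * β * u) * net.disagreement e u :=
    mul_nonneg (by positivity) (intervalIntegral.integral_nonneg hs fun u _ =>
      mul_nonneg (Real.exp_pos _).le (disagreement_nonneg e u))
  have hinit : ∑ i, (φ i ⬝ᵥ ((d.Y i)⁻¹ *ᵥ φ i) + Real.exp (-2 * (d.α i - β) * net.τ i) *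
      net.τ i * (φ i ⬝ᵥ (d.S i *ᵥ φ i))) ≤ C * ∑ i, φ i ⬝ᵥ φ i := by
    rw [Finset.mul_sum]
    refine Finset.sum_le_sum fun i _ => ?_
    have h1 : Real.exp (-2 * (d.α i - β) * net.τ i) ≤ 1 := Real.exp_le_one_iff.2
      (by nlinarith [mul_nonneg (sub_nonneg.2 (hβ i).1) (net.τ_nonneg i)])
    have h2 : Real.exp (-2 * (d.α i - β) * net.τ i) * net.τ i * (φ i ⬝ᵥ (d.S i *ᵥ φ i)) ≤
        net.τ i * (CS i * (φ i ⬝ᵥ φ i)) :=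
      mul_le_mul (mul_le_of_le_one_left (net.τ_nonneg i) h1) (hCS i _)
        ((hd i).2.2.1.quadratic_nonneg _) (net.τ_nonneg i)
    have h3 : CY i + net.τ i * CS i ≤ C :=
      Finset.single_le_sum (f := fun i => CY i + net.τ i * CS i) (fun i _ => hCi i)
        (Finset.mem_univ i)
    have h4 := mul_le_mul_of_nonneg_right h3 (hself (φ i))
    linarith [hCY i (φ i)]
  have hlow : ∑ i, e i s ⬝ᵥ e i s ≤ Λ * ∑ i, e i s ⬝ᵥ ((d.Y i)⁻¹ *ᵥ e i s) := by
    rw [Finset.mul_sum]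
    refine Finset.sum_le_sum fun i _ => ?_
    have h1 : (l i)⁻¹ ≤ Λ := Finset.single_le_sum (f := fun i => (l i)⁻¹)
      (fun i _ => (inv_pos.2 (hl0 i)).le) (Finset.mem_univ i)
    refine le_trans ?_ (mul_le_mul_of_nonneg_right h1 ((hYpd i).posSemidef.quadratic_nonneg _))
    rw [inv_mul_eq_div, le_div_iff₀ (hl0 i), mul_comm]
    exact hl i _
  have hV : Real.exp (2 * β * s) * ∑ i, e i s ⬝ᵥ ((d.Y i)⁻¹ *ᵥ e i s) ≤
      Real.exp (2 * β * net.t m) * (C * ∑ i, φ i ⬝ᵥ φ i) := by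
    have h1 := mul_le_mul_of_nonneg_left hinit (Real.exp_pos (2 * β * net.t m)).le
    have h2 : ∑ i : Fin N, ∫ u in (net.t m)..s, Real.exp (2 * β * u) *
        ((0 : Fin mw ⊕ Fin mv → ℝ) ⬝ᵥ 0) = 0 := by simp
    linarith
  have hexp : Real.exp (-2 * β * (s - net.t m)) * Real.exp (2 * β * s) =
      Real.exp (2 * β * net.t m) := by
    rw [← Real.exp_add]
    congr 1
    ring
  have hVs : ∑ i, e i s ⬝ᵥ ((d.Y i)⁻¹ *ᵥ e i s) ≤
      Real.exp (-2 * β * (s - net.t m)) * (C * ∑ i, φ i ⬝ᵥ φ i) := by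
    refine le_of_mul_le_mul_left ?_ (Real.exp_pos (2 * β * s))
    rw [← mul_assoc, mul_comm (Real.exp (2 * β * s)) (Real.exp _), hexp]
    exact hV
  calc _ ≤ _ := hlow
    _ ≤ _ := mul_le_mul_of_nonneg_left hVs hΛ0
    _ = Λ * C * (Real.exp (-2 * β * (s - net.t m)) * ∑ i, φ i ⬝ᵥ φ i) := by ring
    _ ≤ (Λ * C + 1) * (Real.exp (-2 * β * (s - net.t m)) * ∑ i, φ i ⬝ᵥ φ i) :=
        mul_le_mul_of_nonneg_right (by linarith) (mul_nonneg (Real.exp_pos _).le hφ0)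
    _ = _ := by ring

theorem weight_nonneg {γ : ℝ} (hd : d.Feasible net γ) (i : Fin N) :
    0 ≤ (1 - Real.exp (-2 * d.α i * net.τ i)) / (2 * d.α i) := by
  have hα := (hd i).2.2.2.2.2.1
  refine div_nonneg (sub_nonneg.2 (Real.exp_le_one_iff.2 ?_)) (by positivity)
  nlinarith [mul_nonneg hα.le (net.τ_nonneg i)]

theorem posDef_P {γ : ℝ} (hN : 0 < N) (hd : d.Feasible net γ) : (d.P net).PosDef := by
  have : Nonempty (Fin N) := ⟨⟨0, hN⟩⟩
  refine PosDef.smul ?_ (by positivity)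
  refine Matrix.posDef_sum Finset.univ_nonempty fun i _ => ?_
  exact (hd i).1.inv.add_posSemidef ((hd i).2.2.1.smul (weight_nonneg hd i))

theorem quadratic_P (hN : 0 < N) (x : Fin n → ℝ) :
    (N : ℝ) * (x ⬝ᵥ (d.P net *ᵥ x)) = ∑ i, (x ⬝ᵥ ((d.Y i)⁻¹ *ᵥ x) +
      (1 - Real.exp (-2 * d.α i * net.τ i)) / (2 * d.α i) * (x ⬝ᵥ (d.S i *ᵥ x))) := by
  have hN' : (N : ℝ) ≠ 0 := by positivity
  simp only [P, smul_mulVec, dotProduct_smul, sum_mulVec, dotProduct_sum, add_mulVec,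
    dotProduct_add, smul_eq_mul]
  rw [← mul_assoc, mul_one_div_cancel hN', one_mul]

theorem consensusPerformance {γ : ℝ} (hN : 0 < N) (hγ : 0 < γ) (hd : d.Feasible net γ)
    (hτ : ∀ i, BddAbove (Set.range (net.pollGap i))) :
    net.ConsensusPerformance d.K d.L γ (d.P net) := by
  intro x₀ w v x xh hw hv hx hxh
  have hwc : ∀ c, MemLp (fun u => w u c) 2 (volume.restrict (Set.Ioi 0)) := fun c => hw.eval c
  have hξ : ∀ i c, MemLp (fun u => Sum.elim (w u) (v i u) c) 2 (volume.restrict (Set.Ioi 0)) := by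
    rintro i (c | c)
    · exact hwc c
    · exact (hv i).eval c
  have he := isErrorTrajectory_sub hξ hwc hx hxh
  have hcont : Continuous (net.disagreement xh) := by
    have := hxh.1
    unfold disagreement
    fun_prop
  have hξξ : ∀ i u, Sum.elim (w u) (v i u) ⬝ᵥ Sum.elim (w u) (v i u) =
      w u ⬝ᵥ w u + v i u ⬝ᵥ v i u := fun i u => sumElim_dotProduct_sumElim _ _ _ _
  have hξi : ∀ i, IntegrableOn (fun u => w u ⬝ᵥ w u + v i u ⬝ᵥ v i u) (Set.Ioi 0) := fun i => by
    have := integrable_finsetSum Finset.univ fun c (_ : c ∈ Finset.univ) =>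
      (hξ i c).integrable_mul (hξ i c)
    exact this.congr (Filter.Eventually.of_forall fun u => hξξ i u)
  set M : ℝ := N * (x₀ ⬝ᵥ (d.P net *ᵥ x₀)) +
    ∑ i, ∫ s in Set.Ioi (0 : ℝ), (w s ⬝ᵥ w s + v i s ⬝ᵥ v i s) with hM
  have hbound : ∀ T, 0 ≤ T → ∫ u in (0 : ℝ)..T, net.disagreement xh u ≤ γ ^ 2 * M := by
    intro T hT
    -- Without weight and slack, the energy estimate needs only semidefiniteness of -`Ξ̄_i`.
    have hen := energy_le (δ := fun _ => 0) (β := 0) hd hτ (fun _ => le_rfl)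
      (fun i y => by
        rw [zero_mul]
        exact (hd i).2.2.2.2.2.2.2.2.2.2.2.posSemidef.quadratic_nonneg y)
      le_rfl (fun i => (hd i).2.2.2.2.2.1.le) (fun i y => by simp) (fun i y => by simp)
      (by rw [net.t_zero]; exact hξ) he (T := T) (by rw [net.t_zero]; exact hT)
    simp only [disagreement_sub, mul_zero, zero_mul, Real.exp_zero, one_mul, net.t_zero, hξξ,
      sub_zero] at hen
    have h1 : 0 ≤ ∑ i, (x T - xh i T) ⬝ᵥ ((d.Y i)⁻¹ *ᵥ (x T - xh i T)) :=
      Finset.sum_nonneg fun i _ => (hd i).1.inv.posSemidef.quadratic_nonneg _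
    -- The history cost τe^{-2ατ} does not exceed the coefficient (1 - e^{-2ατ})/(2α) of S_i in P,
    -- since e^{-y}(1 + y) ≤ 1 at y = 2ατ.
    have h2 : ∑ i, (x₀ ⬝ᵥ ((d.Y i)⁻¹ *ᵥ x₀) + Real.exp (-2 * d.α i * net.τ i) * net.τ i *
        (x₀ ⬝ᵥ (d.S i *ᵥ x₀))) ≤ N * (x₀ ⬝ᵥ (d.P net *ᵥ x₀)) := by
      rw [quadratic_P hN]
      refine Finset.sum_le_sum fun i _ => add_le_add_right
        (mul_le_mul_of_nonneg_right ?_ ((hd i).2.2.1.quadratic_nonneg _)) _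
      have hα := (hd i).2.2.2.2.2.1
      rw [le_div_iff₀ (by positivity)]
      have h3 := Real.add_one_le_exp (2 * d.α i * net.τ i)
      have h4 : Real.exp (-2 * d.α i * net.τ i) * Real.exp (2 * d.α i * net.τ i) = 1 := by
        rw [← Real.exp_add]
        simp
      nlinarith [mul_le_mul_of_nonneg_left h3 (Real.exp_pos (-2 * d.α i * net.τ i)).le]
    have h3 : ∑ i, ∫ u in (0 : ℝ)..T, (w u ⬝ᵥ w u + v i u ⬝ᵥ v i u) ≤
        ∑ i, ∫ s in Set.Ioi (0 : ℝ), (w s ⬝ᵥ w s + v i s ⬝ᵥ v i s) := by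
      refine Finset.sum_le_sum fun i _ => ?_
      rw [intervalIntegral.integral_of_le hT]
      refine setIntegral_mono_set (hξi i) (Filter.Eventually.of_forall fun u => ?_)
        (Filter.Eventually.of_forall Set.Ioc_subset_Ioi_self)
      exact add_nonneg (Finset.sum_nonneg fun _ _ => mul_self_nonneg _)
        (Finset.sum_nonneg fun _ _ => mul_self_nonneg _)
    have h4 : 1 / γ ^ 2 * ∫ u in (0 : ℝ)..T, net.disagreement xh u ≤ M := by linarith
    rwa [one_div, inv_mul_le_iff₀ (by positivity)] at h4
  -- The disagreement is nonnegative and its integrals over [0, T] are bounded uniformly in T, so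
  -- the cost is finite.
  have hint : IntegrableOn (net.disagreement xh) (Set.Ioi 0) := by
    refine integrableOn_Ioi_of_intervalIntegral_norm_bounded (γ ^ 2 * M) 0
      (fun T => (hcont.integrableOn_Icc.mono_set Set.Ioc_subset_Icc_self)) Filter.tendsto_id ?_
    filter_upwards [Filter.eventually_ge_atTop 0] with T hT
    simp only [Real.norm_of_nonneg (disagreement_nonneg xh _)]
    exact hbound T hT
  refine ⟨hint, ?_⟩
  have hlim : ∫ s in Set.Ioi (0 : ℝ), net.disagreement xh s ≤ γ ^ 2 * M :=
    le_of_tendsto (intervalIntegral_tendsto_integral_Ioi 0 hint Filter.tendsto_id)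
      ((Filter.eventually_ge_atTop 0).mono fun T hT => hbound T hT)
  have hN' : (0 : ℝ) < N := by exact_mod_cast hN
  calc _ ≤ 1 / (N : ℝ) * (γ ^ 2 * M) := mul_le_mul_of_nonneg_left hlim (by positivity)
    _ = _ := by
      rw [hM]
      field_simp

end RRDesign

theorem theorem2 {N n mw mv : ℕ} (hN : 0 < N) {r h : Fin N → ℕ}
    (net : RRNetwork N n mw mv r h)
    (hτ : ∀ i, BddAbove (Set.range (net.pollGap i)))
    (γ : ℝ) (hγ : 0 < γ)
    (d : RRDesign N n r h) (hd : d.Feasible net γ) :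
    net.SolvesEstimationProblem d.K d.L γ (d.P net) :=
  ⟨RRDesign.exponentiallyStable hd hτ, RRDesign.posDef_P hN hd,
    RRDesign.consensusPerformance hN hγ hd hτ⟩
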